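/- **Setting.** A *twisted $n$-gon* ($n\ge 1$) is a sequence $A=(A_i)_{i\in\mathbb Z}$ of points of the real projective plane such that, for some projective transformation $\phi$, $A_{i+n}=\phi(A_i)$ for all $i$. The *pentagram map* $T$ sends a sequence $A$ indexed by $\mathbb Z$ or by $\frac12+\mathbb Z$ to the sequence $T(A)$ indexed by $\frac12+\mathbb Z$ or $\mathbb Z$, respectively, whose points are $$T(A)_i=\overleftrightarrow{A_{i-3/2}A_{i+1/2}}\cap\overleftrightarrow{A_{i-1/2}A_{i+3/2}};$$ it is defined if, for all indices $i$ of $A$, $A_{i-1}\ne A_{i+1}$ and the lines $\overleftrightarrow{A_{i-1}A_{i+1}}$ and $\overleftrightarrow{A_iA_{i+2}}$ are distinct. Let $\chi(a,b,c,d)=\frac{(a-b)(c-d)}{(a-c)(b-d)}$ be the cross ratio of four collinear points (it is defined if $a\neq c$ and $b\ne d$), and dually of four concurrent lines. The *$y$-parameters* $y_j(A)$, $j\in\mathbb Z$, are given, for each index $m$ of $A$, by $$y_{2m}(A)=-\chi\bigl(\overleftrightarrow{A_mA_{m-2}},\overleftrightarrow{A_mA_{m-1}},\overleftrightarrow{A_mA_{m+1}},\overleftrightarrow{A_mA_{m+2}}\bigr)^{-1},$$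 $$y_{2m+1}(A)=-\chi\bigl(\overleftrightarrow{A_{m-2}A_{m-1}}\cap L,\;A_m,\;A_{m+1},\;\overleftrightarrow{A_{m+2}A_{m+3}}\cap L\bigr),\qquad L=\overleftrightarrow{A_mA_{m+1}};$$ such a parameter is *defined* if the lines and intersection points that occur exist (joined points and intersected lines are distinct), the cross ratio is defined and, in the first case, it is nonzero. For an integer $k$ let $Q_k$ be the set of $(r,s,t)\in\mathbb Z^3$ with $2|s|-(k-2)\le t\le k-2-2|r|$ and $2|s|-(k-2)\equiv t\equiv k-2-2|r|\pmod 4$. For $k\ge 0$ let $P_k=Q_{k+1}\cup Q_k$, with the partial order in which $(r',s',t')$ covers $(r,s,t)$ if and only if $t'=t+1$ and $|r'-r|+|s'-s|=1$, and let $J(P_k)$ be the set of order ideals of $P_k$. For numbers $(y_j)_{j\in\mathbb Z}$ put $$F_{j,k}=\sum_{I\in J(P_k)}\ \prod_{(r,s,t)\in I}y_{3r+s+j}.$$ **Theorem.** Let $A$ be a twisted $n$-gon indexed by $\mathbb Z$ all of whose $y$-parameters $y_j=y_j(A)$ are defined, let $k\ge1$, and suppose that $T^k(A)$ is defined (that is,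 $T$ is defined at $T^i(A)$ for $0\le i<k$). (1) For every $j\in\mathbb Z$ for which $y_j(T^k(A))$ is defined, $$y_j(T^k(A))=\begin{cases}\left(\displaystyle\prod_{i=-k}^{k}y_{j+3i}\right)\dfrac{F_{j-1,k}F_{j+1,k}}{F_{j-3,k}F_{j+3,k}}, & j+k\text{ even},\\[3ex]\left(\displaystyle\prod_{i=-k+1}^{k-1}y_{j+3i}\right)^{-1}\dfrac{F_{j-3,k-1}F_{j+3,k-1}}{F_{j-1,k-1}F_{j+1,k-1}}, & j+k\text{ odd},\end{cases}$$ provided that the polynomials $F$ in the denominator on the right do not vanish at $(y_j)_{j\in\mathbb Z}$. (For $j+k$ odd, the product that is inverted is then nonzero.) (2) If moreover all $y$-parameters of $T^i(A)$ are defined for every $0\le i\le k$, then for every $j\in\mathbb Z$ the polynomials $F$ in the denominator of the corresponding formula do not vanish at $(y_j)_{j\in\mathbb Z}$. -/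

import Mathlib

open scoped LinearAlgebra.Projectivization

noncomputable section

namespace Pentagram

/-! ### The real projective plane, lines, and cross ratios -/

/-- Points of the real projective plane. -/
abbrev Point : Type := ℙ ℝ (Fin 3 → ℝ)

/-- Lines of the real projective plane, in dual homogeneous coordinates: the line with coordinates
`l` consists of the points `p` with `l ⬝ᵥ p = 0`, that is, `Projectivization.orthogonal l p`. -/
abbrev Line : Type := ℙ ℝ (Fin 3 → ℝ)

/-- The line through two points (used only when the points are distinct). -/
def lineThrough (p q : Point) : Line := Projectivization.cross p q

/-- The common point of two lines (used only when the lines are distinct). -/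
def meet (l m : Line) : Point := Projectivization.cross l m

/-- The line `lineThrough p q` is the unique line containing the distinct points `p` and `q`. -/
theorem eq_lineThrough_iff {p q : Point} (h : p ≠ q) (l : Line) :
    l = lineThrough p q ↔
      Projectivization.orthogonal l p ∧ Projectivization.orthogonal l q := by
  constructor
  · rintro rfl
    exact ⟨Projectivization.cross_orthogonal_left h, Projectivization.cross_orthogonal_right h⟩
  · rintro ⟨h1, h2⟩
    unfold lineThrough
    induction p using Projectivization.ind with | h p hp =>
    induction q using Projectivization.ind with | h q hq =>
    induction l using Projectivization.ind with | h l hl =>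
    rw [Projectivization.orthogonal_mk] at h1 h2
    rw [Projectivization.cross_mk_of_ne hp hq h,
      Projectivization.mk_eq_mk_iff_crossProduct_eq_zero]
    rw [dotProduct_comm] at h1 h2
    simp only [dotProduct, Fin.sum_univ_three] at h1 h2
    rw [cross_apply, cross_apply]
    ext i
    fin_cases i <;> simp
    · linear_combination p 0 * h2 - q 0 * h1
    · linear_combination p 1 * h2 - q 1 * h1
    · linear_combination p 2 * h2 - q 2 * h1

/-- The cross ratio `χ(a,b,c,d) = (a-b)(c-d) / ((a-c)(b-d))`, extended to four collinear points of
the projective plane and, dually, to four concurrent lines.  If `n` is a normal vector of the plane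
spanned by representatives of `a, b, c, d`, then each cross product of two of the representatives is
a `2 × 2` determinant of homogeneous coordinates on the line, times `n`; the factor `n ⬝ᵥ n`
cancels.  The two theorems below show that the value does not depend on the representatives, and
that it is the displayed expression in any affine coordinate on the line. -/
def crossRatio (a b c d : ℙ ℝ (Fin 3 → ℝ)) : ℝ :=
  (crossProduct a.rep b.rep ⬝ᵥ crossProduct c.rep d.rep) /
    (crossProduct a.rep c.rep ⬝ᵥ crossProduct b.rep d.rep)

theorem crossRatio_mk {a b c d : Fin 3 → ℝ} (ha : a ≠ 0) (hb : b ≠ 0) (hc : c ≠ 0) (hd : d ≠ 0) :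
    crossRatio (.mk ℝ a ha) (.mk ℝ b hb) (.mk ℝ c hc) (.mk ℝ d hd) =
      (crossProduct a b ⬝ᵥ crossProduct c d) / (crossProduct a c ⬝ᵥ crossProduct b d) := by
  obtain ⟨x, hx⟩ := Projectivization.exists_smul_eq_mk_rep ℝ a ha
  obtain ⟨y, hy⟩ := Projectivization.exists_smul_eq_mk_rep ℝ b hb
  obtain ⟨z, hz⟩ := Projectivization.exists_smul_eq_mk_rep ℝ c hc
  obtain ⟨w, hw⟩ := Projectivization.exists_smul_eq_mk_rep ℝ d hd
  have h0 : (x : ℝ) * y * z * w ≠ 0 := by simp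
  unfold crossRatio
  rw [← hx, ← hy, ← hz, ← hw]
  simp only [Units.smul_def, map_smul, LinearMap.smul_apply, dotProduct_smul, smul_dotProduct,
    smul_eq_mul]
  rw [← mul_div_mul_left _ (crossProduct a c ⬝ᵥ crossProduct b d) h0]
  congr 1 <;> ring

theorem crossRatio_affine {u v : Fin 3 → ℝ} (huv : LinearIndependent ℝ ![u, v]) (a b c d : ℝ)
    (ha : u + a • v ≠ 0) (hb : u + b • v ≠ 0) (hc : u + c • v ≠ 0) (hd : u + d • v ≠ 0) :
    crossRatio (.mk ℝ _ ha) (.mk ℝ _ hb) (.mk ℝ _ hc) (.mk ℝ _ hd) =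
      ((a - b) * (c - d)) / ((a - c) * (b - d)) := by
  have key : ∀ s t : ℝ, crossProduct (u + s • v) (u + t • v) = (t - s) • crossProduct u v := by
    intro s t
    simp only [map_add, map_smul, LinearMap.add_apply, LinearMap.smul_apply, cross_self,
      smul_zero, zero_add, add_zero]
    rw [← cross_anticomm u v, sub_smul, smul_neg]
    abel
  have hn : crossProduct u v ⬝ᵥ crossProduct u v ≠ 0 := by
    rw [Ne, dotProduct_self_eq_zero]
    exact crossProduct_ne_zero_iff_linearIndependent.mpr huv
  rw [crossRatio_mk]
  simp only [key, dotProduct_smul, smul_dotProduct, smul_eq_mul]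
  rw [← mul_div_mul_right ((a - b) * (c - d)) _ hn]
  congr 1 <;> ring

/-- The cross ratio of `a, b, c, d` is a (finite) real number: its denominator does not vanish. -/
def CrossRatioDefined (a b c d : ℙ ℝ (Fin 3 → ℝ)) : Prop := a ≠ c ∧ b ≠ d

/-! ### Polygons and the pentagram map -/

/-- A bi-infinite sequence of points, indexed by `ℤ` (if `half = false`) or by `1/2 + ℤ`
(if `half = true`).  The point whose index is `m`, respectively `m + 1/2`, is `vertex m`. -/
structure Polygon where
  half : Bool
  vertex : ℤ → Point

namespace Polygon

/-- `A` is periodic modulo a projective transformation `φ`: `A_{i+n} = φ(A_i)` for all indices `i`. -/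
def IsTwisted (n : ℕ) (A : Polygon) : Prop :=
  ∃ φ : (Fin 3 → ℝ) ≃ₗ[ℝ] (Fin 3 → ℝ), ∀ m : ℤ,
    A.vertex (m + n) = Projectivization.map φ.toLinearMap φ.injective (A.vertex m)

/-- `d / 2` is an index of `A`. -/
def IsIndex (A : Polygon) (d : ℤ) : Prop := if A.half then Odd d else Even d

/-- `A.at₂ d` is the point `A_{d/2}`, for `d / 2` an index of `A`.  (The division in the code is
rounded down, which is right in both cases: `m + 1/2 = (2m+1)/2` is the index of `vertex m`.) -/
def at₂ (A : Polygon) (d : ℤ) : Point := A.vertex (d / 2)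

/-- The line `A_{d/2} A_{e/2}`. -/
def side (A : Polygon) (d e : ℤ) : Line := lineThrough (A.at₂ d) (A.at₂ e)

/-- The pentagram map can be applied to `A`: for all indices `i`, there are lines
`A_{i-1} A_{i+1}` and `A_i A_{i+2}`, and they are distinct. -/
def PentagramDefined (A : Polygon) : Prop :=
  ∀ d, A.IsIndex d → A.at₂ (d - 2) ≠ A.at₂ (d + 2) ∧ A.at₂ d ≠ A.at₂ (d + 4) ∧
    A.side (d - 2) (d + 2) ≠ A.side d (d + 4)

/-- The pentagram map `T`.  If `A` is indexed by `ℤ` then `T(A)` is indexed by `1/2 + ℤ`, and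
vice versa; the vertex of `T(A)` with index `i = d / 2` is
`A_{i-3/2} A_{i+1/2} ∩ A_{i-1/2} A_{i+3/2}`. -/
def pentagramMap (A : Polygon) : Polygon where
  half := !A.half
  vertex m :=
    let d : ℤ := if A.half then 2 * m else 2 * m + 1
    meet (A.side (d - 3) (d + 1)) (A.side (d - 1) (d + 3))

/-- `T^k(A)` is defined. -/
def IterDefined (A : Polygon) (k : ℕ) : Prop :=
  ∀ i < k, (pentagramMap^[i] A).PentagramDefined

/-! ### The `y`-parameters -/

/-- The cross ratio of the lines from `A_i` to `A_{i-2}`, `A_{i-1}`, `A_{i+1}`, `A_{i+2}`,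
where `i = d / 2`. -/
def vertexCrossRatio (A : Polygon) (d : ℤ) : ℝ :=
  crossRatio (A.side d (d - 4)) (A.side d (d - 2)) (A.side d (d + 2)) (A.side d (d + 4))

/-- The four lines exist, and their cross ratio is a nonzero real number. -/
def VertexDefined (A : Polygon) (d : ℤ) : Prop :=
  A.at₂ d ≠ A.at₂ (d - 4) ∧ A.at₂ d ≠ A.at₂ (d - 2) ∧
  A.at₂ d ≠ A.at₂ (d + 2) ∧ A.at₂ d ≠ A.at₂ (d + 4) ∧
  CrossRatioDefined
    (A.side d (d - 4)) (A.side d (d - 2)) (A.side d (d + 2)) (A.side d (d + 4)) ∧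
  A.vertexCrossRatio d ≠ 0

/-- The cross ratio of the points `A_{i-2} A_{i-1} ∩ L`, `A_i`, `A_{i+1}`, `A_{i+2} A_{i+3} ∩ L`,
where `i = d / 2` and `L = A_i A_{i+1}`. -/
def edgeCrossRatio (A : Polygon) (d : ℤ) : ℝ :=
  crossRatio (meet (A.side (d - 4) (d - 2)) (A.side d (d + 2))) (A.at₂ d) (A.at₂ (d + 2))
    (meet (A.side (d + 4) (d + 6)) (A.side d (d + 2)))

/-- The lines and the intersection points exist, and the cross ratio is a real number. -/
def EdgeDefined (A : Polygon) (d : ℤ) : Prop :=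
  A.at₂ (d - 4) ≠ A.at₂ (d - 2) ∧ A.at₂ d ≠ A.at₂ (d + 2) ∧ A.at₂ (d + 4) ≠ A.at₂ (d + 6) ∧
  A.side (d - 4) (d - 2) ≠ A.side d (d + 2) ∧ A.side (d + 4) (d + 6) ≠ A.side d (d + 2) ∧
  CrossRatioDefined (meet (A.side (d - 4) (d - 2)) (A.side d (d + 2))) (A.at₂ d) (A.at₂ (d + 2))
    (meet (A.side (d + 4) (d + 6)) (A.side d (d + 2)))

open Classical in
/-- The parameter `y_j(A)`: for an index `i` of `A`, `y_{2i}(A)` is minus the inverse of the cross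
ratio at the vertex `A_i`, and `y_{2i+1}(A)` is minus the cross ratio on the edge `A_i A_{i+1}`. -/
def y (A : Polygon) (j : ℤ) : ℝ :=
  if A.IsIndex j then -(A.vertexCrossRatio j)⁻¹ else -A.edgeCrossRatio (j - 1)

/-- The parameter `y_j(A)` is defined. -/
def YDefined (A : Polygon) (j : ℤ) : Prop :=
  (A.IsIndex j → A.VertexDefined j) ∧ (¬ A.IsIndex j → A.EdgeDefined (j - 1))

end Polygon

/-! ### The posets `P_k` and the polynomials `F_{j,k}` -/

/-- The set `Q_k` of triples `(r, s, t)`. -/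
def Q (k : ℤ) : Set (ℤ × ℤ × ℤ) :=
  {x | 2 * |x.2.1| - (k - 2) ≤ x.2.2 ∧ x.2.2 ≤ k - 2 - 2 * |x.1| ∧
    2 * |x.2.1| - (k - 2) ≡ x.2.2 [ZMOD 4] ∧ x.2.2 ≡ k - 2 - 2 * |x.1| [ZMOD 4]}

/-- The elements of `P_k = Q_{k+1} ∪ Q_k`. -/
structure P (k : ℕ) where
  r : ℤ
  s : ℤ
  t : ℤ
  mem : (r, s, t) ∈ Q (k + 1) ∪ Q k

namespace P

variable {k : ℕ}

/-- `b.Covers a`: the element `b` of `P_k` covers `a`. -/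
def Covers (b a : P k) : Prop := b.t = a.t + 1 ∧ |b.r - a.r| + |b.s - a.s| = 1

theorem t_le_of_reach {a b : P k} (h : Relation.ReflTransGen (fun a b : P k => b.Covers a) a b) :
    a = b ∨ a.t < b.t := by
  induction h with
  | refl => exact Or.inl rfl
  | tail _ hc ih =>
    right
    have h1 := hc.1
    rcases ih with rfl | ih <;> omega

/-- The partial order on `P_k` generated by the covering relation. -/
instance : PartialOrder (P k) where
  le := Relation.ReflTransGen (fun a b : P k => b.Covers a)
  le_refl _ := Relation.ReflTransGen.refl
  le_trans _ _ _ := Relation.ReflTransGen.trans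
  le_antisymm a b h h' := by
    rcases t_le_of_reach h with h | h
    · exact h
    · rcases t_le_of_reach h' with h' | h'
      · exact h'.symm
      · omega

instance : Finite (P k) := by
  let B : Set ℤ := Set.Icc (-(k : ℤ)) k
  have hB : B.Finite := Set.finite_Icc _ _
  have : Finite B := hB
  have hb : ∀ x : P k, x.r ∈ B ∧ x.s ∈ B ∧ x.t ∈ B := by
    intro x
    have h1 := abs_nonneg x.r
    have h2 := abs_nonneg x.s
    have h3 := neg_abs_le x.r
    have h4 := neg_abs_le x.s
    have h5 := le_abs_self x.r
    have h6 := le_abs_self x.s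
    simp only [B, Set.mem_Icc]
    rcases x.mem with h | h <;> simp only [Q, Set.mem_ofPred_eq] at h <;>
      obtain ⟨h7, h8, -, -⟩ := h <;> omega
  refine Finite.of_injective
    (fun x : P k => ((⟨x.r, (hb x).1⟩, ⟨x.s, (hb x).2.1⟩, ⟨x.t, (hb x).2.2⟩) : B × B × B)) ?_
  rintro ⟨r, s, t, h⟩ ⟨r', s', t', h'⟩ e
  simp only [Prod.mk.injEq, Subtype.mk.injEq] at e
  obtain ⟨rfl, rfl, rfl⟩ := e
  rfl

instance : Finite (LowerSet (P k)) :=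
  Finite.of_injective (fun I : LowerSet (P k) => (I : Set (P k))) SetLike.coe_injective

instance : Fintype (P k) := Fintype.ofFinite _

instance : Fintype (LowerSet (P k)) := Fintype.ofFinite _

end P

open Classical in
/-- The polynomial `F_{j,k}`, evaluated at a sequence `y`: the sum over the order ideals `I` of
`P_k` (lower sets, in Mathlib's terms) of the products of `y_{3r+s+j}` over `(r, s, t) ∈ I`. -/
def F (y : ℤ → ℝ) (j : ℤ) (k : ℕ) : ℝ :=
  ∑ I : LowerSet (P k), ∏ x : P k with x ∈ I, y (3 * x.r + x.s + j)

end Pentagram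

end

/-!
The proof follows the `y`-parameters along the iterates of the pentagram map and shows that the
polynomials `F` change by a simple factor under one step.

*One step.*  Write `[p, q, r]` for the determinant of homogeneous coordinates of three vertices.
Both kinds of `y`-parameters are monomials in the brackets of the triples of indices `i, i+1, i+2`,
of `i, i+1, i+3` and of `i, i+2, i+3`; by a Plücker relation `1 + y` at a vertex is one as well, if
the triples `i, i+2, i+4` are admitted.  The brackets of the first three kinds of `T(A)` are again
products of brackets of `A`.  Comparing monomials shows that `y(T(A))` arises from `y(A)` by the
mutation rule `IsMutation` (`IsGeneric.isMutation`).

*Mutation of `F`.*  Suppose that `y'` is the mutation of `y`.  An order ideal of `P_{k+1}`, or of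
`P_k`, is determined by its numbers of elements in the columns over `(r, s)`, and these numbers are
subject only to inequalities between neighbouring columns.  The columns of `Q_{k+1}`, common to both
posets, have `r + s` of one parity; once the ideal is fixed there, the remaining columns are
independent of each other, so that the sum over the ideal factors.  The factor that a column
contributes to `F y j (k + 1)` is, up to the powers of `y / (1 + y)` and `1 + y` that turn the
neighbouring variables into their mutations, the factor that it contributes to `F y' j k`
(`sum_upperRange`).  Hence `F y j (k + 1) = mutationFactor y j k * F y' j k` (`IsMutation.F_succ`).

The formula for `y(T^k(A))` in terms of `y(A)` follows by induction on `k`, applied to `T(A)`, when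
all the polygons up to `T^k(A)` are generic (`eq_of_isMutation`); the case of odd `j + k` is the
reciprocal of the even case for `k - 1`.  In that situation each `mutationFactor` is nonzero, so the
polynomials in the denominators do not vanish (`F_ne_zero_of_isMutation`).

*Degenerate iterates.*  For the first part the intermediate polygons may fail to have
`y`-parameters.  The vertices of `A` are joined by a segment, in coordinates, to those of a polygon
inscribed in a parabola, all of whose iterates are inscribed in parabolas too.  The brackets of the
iterates are polynomials in the deformation parameter `x` that do not vanish at `x = 1`, so generic
`x` are arbitrarily close to `0` (`frequently_isGeneric`).  Both sides of the formula are continuous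
at `x = 0`, so the formula persists there.
-/

noncomputable section

namespace Pentagram

/-! ### Order ideals of `P_k` as functions on columns -/

/-- The least third coordinate of an element of `P_k` in the column over `c = (r, s)`. -/
def colBot (k : ℕ) (c : ℤ × ℤ) : ℤ := 2 * |c.2| - k + 2 - (c.1 + c.2 + k) % 2

/-- The number of elements of `P_k` in the column over `c = (r, s)`; their third coordinates are
`colBot k c + 4 * i` with `i < colSize k c`. -/
def colSize (k : ℕ) (c : ℤ × ℤ) : ℕ := ((k + 1 - |c.1| - |c.2|) / 2).toNat

theorem mem_Q_union_iff (k : ℕ) (r s t : ℤ) :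
    (r, s, t) ∈ Q (k + 1) ∪ Q k ↔ ∃ i : ℕ, i < colSize k (r, s) ∧ t = colBot k (r, s) + 4 * i := by
  simp only [Set.mem_union, Q, Set.mem_ofPred_eq, colSize, colBot, Int.ModEq]
  have hr : |r| = r ∨ |r| = -r := abs_choice r
  have hs : |s| = s ∨ |s| = -s := abs_choice s
  have hr0 := abs_nonneg r
  have hs0 := abs_nonneg s
  generalize |r| = a at *
  generalize |s| = b at *
  constructor
  · rintro (⟨h1, h2, h3, h4⟩ | ⟨h1, h2, h3, h4⟩)
    · exact ⟨((t - (2 * b - k + 1)) / 4).toNat, by omega, by omega⟩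
    · exact ⟨((t - (2 * b - k + 2)) / 4).toNat, by omega, by omega⟩
  · rintro ⟨i, h1, rfl⟩
    rcases Int.emod_two_eq_zero_or_one (r + s + k) with h | h
    · right
      omega
    · left
      omega

namespace P

variable {k : ℕ}

/-- The column of an element of `P_k`. -/
def col (x : P k) : ℤ × ℤ := (x.r, x.s)

/-- The position of an element of `P_k` in its column, counted from `0`. -/
def idx (x : P k) : ℕ := ((x.t - colBot k x.col) / 4).toNat

theorem exists_eq_of_mem (x : P k) : x.idx < colSize k x.col ∧ x.t = colBot k x.col + 4 * x.idx := by
  obtain ⟨i, h1, h2⟩ := (mem_Q_union_iff k x.r x.s x.t).1 x.mem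
  have h : x.idx = i := by
    unfold idx col
    omega
  rw [h]
  exact ⟨h1, h2⟩

theorem idx_lt (x : P k) : x.idx < colSize k x.col := x.exists_eq_of_mem.1

theorem t_eq (x : P k) : x.t = colBot k x.col + 4 * x.idx := x.exists_eq_of_mem.2

/-- The element of `P_k` in position `i` of the column over `c`. -/
def ofIdx (c : ℤ × ℤ) (i : ℕ) (h : i < colSize k c) : P k :=
  ⟨c.1, c.2, colBot k c + 4 * i, (mem_Q_union_iff k c.1 c.2 _).2 ⟨i, h, rfl⟩⟩

@[simp] theorem col_ofIdx (c : ℤ × ℤ) (i : ℕ) (h : i < colSize k c) : (ofIdx c i h).col = c := rfl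

@[simp] theorem idx_ofIdx (c : ℤ × ℤ) (i : ℕ) (h : i < colSize k c) : (ofIdx c i h).idx = i := by
  simp [idx, col, ofIdx]

theorem ext_col_idx {x x' : P k} (h : x.col = x'.col) (h' : x.idx = x'.idx) : x = x' := by
  have ht : x.t = x'.t := by rw [x.t_eq, x'.t_eq, h, h']
  obtain ⟨r, s, t, _⟩ := x
  obtain ⟨r', s', t', _⟩ := x'
  simp only [col, Prod.mk.injEq] at h ht
  obtain ⟨rfl, rfl⟩ := h
  subst ht
  rfl

theorem le_of_covers {a b : P k} (h : b.Covers a) : a ≤ b := Relation.ReflTransGen.single h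

/-- Elements over columns with `r + s ≡ k` cover elements in the same position of the two columns
next to them in the `r`-direction; elements over the other columns cover elements of the two columns
next to them in the `s`-direction, the position dropping by one when `|s|` grows. -/
theorem covers_iff (a b : P k) : b.Covers a ↔
    ((b.r + b.s + k) % 2 = 0 ∧ a.s = b.s ∧ |b.r - a.r| = 1 ∧ a.idx = b.idx) ∨
    ((b.r + b.s + k) % 2 = 1 ∧ a.r = b.r ∧ |b.s - a.s| = 1 ∧
      a.idx + (if |b.s| < |a.s| then 1 else 0) = b.idx) := by
  have ha := a.t_eq
  have hb := b.t_eq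
  unfold Covers
  simp only [colBot, col] at ha hb
  generalize a.idx = i at *
  generalize b.idx = i' at *
  rw [ha, hb]
  have h1 := abs_cases a.s
  have h2 := abs_cases b.s
  have h3 := abs_cases (b.r - a.r)
  have h4 := abs_cases (b.s - a.s)
  generalize |a.s| = as at *
  generalize |b.s| = bs at *
  generalize |b.r - a.r| = dr at *
  generalize |b.s - a.s| = ds at *
  split_ifs with h5
  · omega
  · omega

theorem ofIdx_covers_r {c d : ℤ × ℤ} {i : ℕ} (hc : i < colSize k c) (hd : i < colSize k d)
    (h : (c.1 + c.2 + k) % 2 = 0) (h1 : d.2 = c.2) (h2 : |c.1 - d.1| = 1) :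
    ofIdx d i hd ≤ ofIdx c i hc :=
  le_of_covers ((covers_iff _ _).2 (Or.inl ⟨h, h1, h2, by simp⟩))

theorem ofIdx_covers_s {c d : ℤ × ℤ} {i i' : ℕ} (hc : i < colSize k c) (hd : i' < colSize k d)
    (h : (c.1 + c.2 + k) % 2 = 1) (h1 : d.1 = c.1) (h2 : |c.2 - d.2| = 1)
    (h3 : i' + (if |c.2| < |d.2| then 1 else 0) = i) :
    ofIdx d i' hd ≤ ofIdx c i hc :=
  le_of_covers ((covers_iff _ _).2 (Or.inr ⟨h, h1, h2, by rw [idx_ofIdx, idx_ofIdx]; exact h3⟩))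

/-- Each column is a chain. -/
theorem ofIdx_le_succ (c : ℤ × ℤ) (i : ℕ) (h : i + 1 < colSize k c) :
    ofIdx c i (by omega) ≤ ofIdx c (i + 1) h := by
  obtain ⟨r, s⟩ := c
  have habs : ∀ z : ℤ, z ≠ 0 → ∃ w, |z - w| = 1 ∧ |w| + 1 = |z| := fun z hz => by
    rcases lt_or_gt_of_ne hz with hz | hz
    · exact ⟨z + 1, by simp, by rw [abs_of_neg hz, abs_of_nonpos (by omega)]; omega⟩
    · exact ⟨z - 1, by simp, by rw [abs_of_pos hz, abs_of_nonneg (by omega)]; omega⟩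
  have hsz := h
  simp only [colSize] at hsz
  have hr1 : |r + 1| ≤ |r| + 1 := by simpa using abs_add_le r 1
  have hr0 := abs_nonneg (r + 1)
  have hr2 := abs_choice r
  have hs2 := abs_choice s
  have hpar : ∀ z w : ℤ, |z - w| = 1 → z = w + 1 ∨ z = w - 1 := fun z w h => by
    have := abs_cases (z - w); omega
  have hd1 : |r - (r + 1)| = 1 := by simp
  have hd2 : |r + 1 - r| = 1 := by simp
  rcases Int.emod_two_eq_zero_or_one (r + s + k) with hp | hp
  · rcases eq_or_ne s 0 with rfl | hs
    · have b1 : i + 1 < colSize k (r + 1, 0) := by simp only [colSize, abs_zero] at *; omega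
      have b2 : i < colSize k (r + 1, 1) := by simp only [colSize, abs_zero, abs_one] at *; omega
      have b3 : i < colSize k (r, 1) := by simp only [colSize, abs_zero, abs_one] at *; omega
      refine le_trans (ofIdx_covers_s b3 _ ?_ rfl (by simp) (by simp)) <|
        le_trans (ofIdx_covers_r b2 b3 ?_ rfl ?_) <|
        le_trans (ofIdx_covers_s b1 b2 ?_ rfl (by simp) (by simp)) <|
        ofIdx_covers_r h b1 hp rfl ?_ <;> simp only [hd1, hd2] <;> omega
    · obtain ⟨w, hw1, hw2⟩ := habs s hs
      have hw3 := hpar _ _ hw1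
      have hw4 : |w - s| = 1 := by rw [abs_sub_comm]; exact hw1
      have b1 : i + 1 < colSize k (r + 1, s) := by simp only [colSize]; omega
      have b2 : i + 1 < colSize k (r + 1, w) := by simp only [colSize]; omega
      have b3 : i + 1 < colSize k (r, w) := by simp only [colSize]; omega
      have e1 : |w| < |s| := by omega
      have e2 : ¬ |s| < |w| := by omega
      refine le_trans (ofIdx_covers_s b3 _ ?_ rfl hw4 (by simp [e1])) <|
        le_trans (ofIdx_covers_r b2 b3 ?_ rfl hd2) <|
        le_trans (ofIdx_covers_s b1 b2 ?_ rfl hw1 (by simp [e2])) <|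
        ofIdx_covers_r h b1 hp rfl hd1 <;> simp only <;> omega
  · rcases eq_or_ne s 0 with rfl | hs
    · have b1 : i < colSize k (r, 1) := by simp only [colSize, abs_zero, abs_one] at *; omega
      have b2 : i < colSize k (r + 1, 1) := by simp only [colSize, abs_zero, abs_one] at *; omega
      have b3 : i < colSize k (r + 1, 0) := by simp only [colSize, abs_zero, abs_one] at *; omega
      refine le_trans (ofIdx_covers_r b3 _ ?_ rfl hd2) <|
        le_trans (ofIdx_covers_s b2 b3 ?_ rfl (by simp) (by simp)) <|
        le_trans (ofIdx_covers_r b1 b2 ?_ rfl hd1) <|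
        ofIdx_covers_s h b1 hp rfl (by simp) (by simp) <;> simp only <;> omega
    · obtain ⟨w, hw1, hw2⟩ := habs s hs
      have hw3 := hpar _ _ hw1
      have hw4 : |w - s| = 1 := by rw [abs_sub_comm]; exact hw1
      have b1 : i + 1 < colSize k (r, w) := by simp only [colSize]; omega
      have b2 : i + 1 < colSize k (r + 1, w) := by simp only [colSize]; omega
      have b3 : i < colSize k (r + 1, s) := by simp only [colSize]; omega
      have e1 : |w| < |s| := by omega
      have e2 : ¬ |s| < |w| := by omega
      refine le_trans (ofIdx_covers_r b3 _ ?_ rfl hd2) <|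
        le_trans (ofIdx_covers_s b2 b3 ?_ rfl hw4 (by simp [e1])) <|
        le_trans (ofIdx_covers_r b1 b2 ?_ rfl hd1) <|
        ofIdx_covers_s h b1 hp rfl hw1 (by simp [e2]) <;> simp only <;> omega

theorem ofIdx_le_ofIdx (c : ℤ × ℤ) {i i' : ℕ} (hi : i ≤ i') (h : i' < colSize k c) :
    ofIdx c i (by omega) ≤ ofIdx c i' h := by
  induction i', hi using Nat.le_induction with
  | base => exact le_rfl
  | succ m hm ih => exact le_trans (ih (by omega)) (ofIdx_le_succ c m h)

theorem le_of_idx_le {x x' : P k} (h : x.col = x'.col) (h' : x.idx ≤ x'.idx) : x ≤ x' := by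
  have hx : x = ofIdx x'.col x.idx (by have := x'.idx_lt; omega) := ext_col_idx (by simp [h]) (by simp)
  have hx' : x' = ofIdx x'.col x'.idx x'.idx_lt := ext_col_idx (by simp) (by simp)
  have := ofIdx_le_ofIdx x'.col h' x'.idx_lt
  rwa [← hx, ← hx'] at this

end P

/-- A function on columns is a height function of `P_k` if it counts the elements of some order
ideal in each column; the inequalities express that the ideal is closed under the two kinds of
covering relations. -/
structure IsHeight (k : ℕ) (n : ℤ × ℤ → ℕ) : Prop where
  le_size : ∀ c, n c ≤ colSize k c
  le_r : ∀ l u : ℤ × ℤ, (l.1 + l.2 + k) % 2 = 0 → u.2 = l.2 → |l.1 - u.1| = 1 → n l ≤ n u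
  le_s : ∀ u l : ℤ × ℤ, (u.1 + u.2 + k) % 2 = 1 → l.1 = u.1 → |u.2 - l.2| = 1 →
    n u ≤ n l + if |u.2| < |l.2| then 1 else 0

theorem mem_iff_lt_card_of_downClosed (S : Finset ℕ) (h : ∀ i ∈ S, ∀ i' ≤ i, i' ∈ S) (i : ℕ) :
    i ∈ S ↔ i < S.card := by
  constructor
  · intro hi
    have : Finset.range (i + 1) ⊆ S := fun i' hi' => h i hi i' (by simpa [Nat.lt_succ_iff] using hi')
    simpa using Finset.card_le_card this
  · intro hi
    by_contra hc
    have : S ⊆ Finset.range i := fun i' hi' => by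
      rw [Finset.mem_range]
      by_contra hlt
      exact hc (h i' hi' i (by omega))
    have := Finset.card_le_card this
    simp at this
    omega

namespace P

variable {k : ℕ}

open Classical in
/-- The number of elements of an order ideal in each column. -/
def height (I : LowerSet (P k)) (c : ℤ × ℤ) : ℕ :=
  (Finset.univ.filter fun x : P k => x ∈ I ∧ x.col = c).card

/-- An order ideal contains an initial segment of each column, so it is determined by its heights. -/
theorem mem_iff_idx_lt_height (I : LowerSet (P k)) (x : P k) :
    x ∈ I ↔ x.idx < height I x.col := by
  classical
  set T := Finset.univ.filter fun x' : P k => x' ∈ I ∧ x'.col = x.col with hT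
  have hinj : Set.InjOn (idx (k := k)) T := by
    intro a ha b hb hab
    simp only [hT, Finset.coe_filter, Finset.mem_univ, true_and, Set.mem_ofPred_eq] at ha hb
    exact ext_col_idx (ha.2.trans hb.2.symm) hab
  have hcard : height I x.col = (T.image idx).card := (Finset.card_image_of_injOn hinj).symm
  rw [hcard, ← mem_iff_lt_card_of_downClosed]
  · simp only [hT, Finset.mem_image, Finset.mem_filter, Finset.mem_univ, true_and]
    constructor
    · intro hx
      exact ⟨x, ⟨hx, rfl⟩, rfl⟩
    · rintro ⟨a, ⟨ha, ha'⟩, h⟩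
      rwa [← ext_col_idx ha' h]
  · simp only [hT, Finset.mem_image, Finset.mem_filter, Finset.mem_univ, true_and]
    rintro _ ⟨a, ⟨ha, ha'⟩, rfl⟩ i' hi'
    refine ⟨ofIdx a.col i' (lt_of_le_of_lt hi' a.idx_lt), ⟨I.lower ?_ ha, by simp [ha']⟩, by simp⟩
    exact le_of_idx_le (by simp) (by simpa using hi')

theorem height_eq (I : LowerSet (P k)) (c : ℤ × ℤ) (m : ℕ) (hm : m ≤ colSize k c)
    (h : ∀ i (hi : i < colSize k c), ofIdx c i hi ∈ I ↔ i < m) : height I c = m := by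
  have h1 : height I c ≤ colSize k c := by
    classical
    calc height I c ≤ (Finset.range (colSize k c)).card :=
          Finset.card_le_card_of_injOn (idx (k := k))
            (fun a ha => by
              simp only [Finset.coe_filter, Finset.mem_univ, true_and, Set.mem_ofPred_eq] at ha
              simpa [← ha.2] using a.idx_lt)
            (fun a ha b hb hab => by
              simp only [Finset.coe_filter, Finset.mem_univ, true_and, Set.mem_ofPred_eq] at ha hb
              exact ext_col_idx (ha.2.trans hb.2.symm) hab)
      _ = _ := Finset.card_range _
  have h2 : ∀ i, i < colSize k c → (i < height I c ↔ i < m) := fun i hi => by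
    rw [← h i hi, mem_iff_idx_lt_height]
    simp
  rcases lt_trichotomy (height I c) m with hlt | heq | hgt
  · have := (h2 _ (lt_of_lt_of_le hlt hm)).2 hlt
    omega
  · exact heq
  · have := (h2 _ (lt_of_lt_of_le hgt h1)).1 hgt
    omega

theorem height_le (I : LowerSet (P k)) (c : ℤ × ℤ) : height I c ≤ colSize k c := by
  by_contra hlt
  rw [not_le] at hlt
  have h := height_eq I c (colSize k c) le_rfl fun i hi => by
    rw [mem_iff_idx_lt_height]
    simp only [idx_ofIdx, col_ofIdx]
    omega
  omega

theorem colSize_le_of_r {l u : ℤ × ℤ} (hl : (l.1 + l.2 + k) % 2 = 0) (h2 : u.2 = l.2)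
    (h1 : |l.1 - u.1| = 1) : colSize k l ≤ colSize k u := by
  unfold colSize
  have := abs_cases (l.1 - u.1)
  have := abs_cases l.1
  have := abs_cases u.1
  have := abs_cases l.2
  rw [h2]
  generalize |l.1| = a at *
  generalize |u.1| = b at *
  generalize |l.2| = b at *
  omega

theorem colSize_le_of_s {u l : ℤ × ℤ} (hu : (u.1 + u.2 + k) % 2 = 1) (h2 : l.1 = u.1)
    (h1 : |u.2 - l.2| = 1) : colSize k u ≤ colSize k l + if |u.2| < |l.2| then 1 else 0 := by
  unfold colSize
  have := abs_cases (u.2 - l.2)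
  have := abs_cases l.2
  have := abs_cases u.2
  have := abs_cases u.1
  rw [h2]
  generalize |u.1| = a at *
  generalize |u.2| = b at *
  generalize |l.2| = b at *
  split_ifs <;> omega

theorem isHeight_height (I : LowerSet (P k)) : IsHeight k (height I) where
  le_size := height_le I
  le_r l u hl h2 h1 := by
    by_contra hlt
    rw [not_le] at hlt
    have hs := colSize_le_of_r hl h2 h1
    have hh := height_le I l
    have hml : ofIdx l (height I u) (by omega) ∈ I := by
      rw [mem_iff_idx_lt_height]; simpa using hlt
    have := I.lower (ofIdx_covers_r _ (show height I u < colSize k u by omega) hl h2 h1) hml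
    rw [SetLike.mem_coe, mem_iff_idx_lt_height] at this
    simp at this
  le_s u l hu h2 h1 := by
    by_contra hlt
    rw [not_le] at hlt
    have hs := colSize_le_of_s hu h2 h1
    have hh := height_le I u
    have hml : ofIdx u (height I l + if |u.2| < |l.2| then 1 else 0) (by omega) ∈ I := by
      rw [mem_iff_idx_lt_height]; simpa using hlt
    have := I.lower (ofIdx_covers_s _ (show height I l < colSize k l by omega) hu h2 h1 rfl) hml
    rw [SetLike.mem_coe, mem_iff_idx_lt_height] at this
    simp at this

/-- The order ideal with a given height function. -/
def ofHeight (n : ℤ × ℤ → ℕ) (hn : IsHeight k n) : LowerSet (P k) where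
  carrier := {x | x.idx < n x.col}
  lower' := by
    intro b a hab hb
    change Relation.ReflTransGen _ a b at hab
    induction hab with
    | refl => exact hb
    | @tail c d _ hc ih =>
      refine ih ?_
      simp only [Set.mem_ofPred_eq] at hb ⊢
      rcases (covers_iff _ _).1 hc with ⟨h1, h2, h3, h4⟩ | ⟨h1, h2, h3, h4⟩
      · have := hn.le_r d.col c.col h1 h2 h3
        omega
      · have : n d.col ≤ n c.col + if |d.s| < |c.s| then 1 else 0 := hn.le_s d.col c.col h1 h2 h3
        omega

theorem height_ofHeight (n : ℤ × ℤ → ℕ) (hn : IsHeight k n) : height (ofHeight n hn) = n := by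
  ext c
  refine height_eq _ c (n c) (hn.le_size c) fun i hi => ?_
  change (ofIdx c i hi).idx < n (ofIdx c i hi).col ↔ i < n c
  simp

theorem height_injective : Function.Injective (height (k := k)) := by
  intro I I' h
  ext x
  change x ∈ I ↔ x ∈ I'
  rw [mem_iff_idx_lt_height, mem_iff_idx_lt_height, h]

end P

open Classical in
/-- The height functions of the order ideals of `P_k`. -/
def heights (k : ℕ) : Finset (ℤ × ℤ → ℕ) := Finset.univ.image (P.height (k := k))

theorem mem_heights {k : ℕ} {n : ℤ × ℤ → ℕ} : n ∈ heights k ↔ IsHeight k n := by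
  simp only [heights, Finset.mem_image, Finset.mem_univ, true_and]
  constructor
  · rintro ⟨I, rfl⟩
    exact P.isHeight_height I
  · intro hn
    exact ⟨_, P.height_ofHeight n hn⟩

theorem F_eq_sum_heights (y : ℤ → ℝ) (j : ℤ) (k : ℕ) (S : Finset (ℤ × ℤ))
    (hS : ∀ c, colSize k c ≠ 0 → c ∈ S) :
    F y j k = ∑ n ∈ heights k, ∏ c ∈ S, y (3 * c.1 + c.2 + j) ^ n c := by
  classical
  unfold F heights
  rw [Finset.sum_image (P.height_injective.injOn)]
  refine Finset.sum_congr rfl fun I _ => ?_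
  rw [← Finset.prod_fiberwise_of_maps_to (t := S) (g := P.col)
    (fun x _ => hS _ (by have := x.idx_lt; omega))]
  refine Finset.prod_congr rfl fun c _ => ?_
  rw [Finset.filter_filter]
  have : ∀ x ∈ Finset.univ.filter (fun x : P k => x ∈ I ∧ x.col = c),
      y (3 * x.r + x.s + j) = y (3 * c.1 + c.2 + j) := fun x hx => by
    simp only [Finset.mem_filter, Finset.mem_univ, true_and] at hx
    rw [← hx.2]
    rfl
  rw [Finset.prod_congr rfl this, Finset.prod_const, P.height]

/-- A sum over functions with independent constraints at the points of `E`, and prescribed values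
elsewhere, of a product over `E` is a product of sums. -/
theorem sum_prod_eq_prod_sum {α R : Type*} [DecidableEq α] [CommRing R] (E : Finset α) (q : α → ℕ)
    (t : α → Finset ℕ) (V : Finset (α → ℕ))
    (hV : ∀ n, n ∈ V ↔ (∀ c, c ∉ E → n c = q c) ∧ ∀ e ∈ E, n e ∈ t e) (f : α → ℕ → R) :
    ∑ n ∈ V, ∏ e ∈ E, f e (n e) = ∏ e ∈ E, ∑ i ∈ t e, f e i := by
  rw [Finset.prod_sum]
  refine Finset.sum_bij' (fun n _ => fun e _ => n e)
    (fun p _ => fun c => if h : c ∈ E then p c h else q c) ?_ ?_ ?_ ?_ ?_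
  · intro n hn
    rw [Finset.mem_pi]
    exact fun e he => ((hV n).1 hn).2 e he
  · intro p hp
    rw [Finset.mem_pi] at hp
    rw [hV]
    exact ⟨fun c hc => by simp [hc], fun e he => by simpa [he] using hp e he⟩
  · intro n hn
    ext c
    by_cases h : c ∈ E
    · simp [h]
    · simp [h, ((hV n).1 hn).1 c h]
  · intro p hp
    ext e he
    simp [he]
  · intro n hn
    exact (Finset.prod_attach E fun e => f e (n e)).symm

/-! ### Summing over every other column -/

/-- The columns `(r, s)` with `r + s ≡ k` that can be nonempty in `P_{k+1}` or in `P_k`. -/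
def evenCols (k : ℕ) : Finset (ℤ × ℤ) :=
  (Finset.Icc (-(k : ℤ)) k ×ˢ Finset.Icc (-(k : ℤ)) k).filter fun c =>
    |c.1| + |c.2| ≤ k ∧ (c.1 + c.2 + k) % 2 = 0

/-- The columns of the elements of `Q_{k+1}`, that is, of the common part of `P_{k+1}` and `P_k`. -/
def oddCols (k : ℕ) : Finset (ℤ × ℤ) :=
  (Finset.Icc (-(k : ℤ)) k ×ˢ Finset.Icc (-(k : ℤ)) k).filter fun c =>
    |c.1| + |c.2| + 1 ≤ k ∧ (c.1 + c.2 + k) % 2 = 1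

section Columns

variable {k : ℕ}

theorem mem_evenCols {c : ℤ × ℤ} :
    c ∈ evenCols k ↔ |c.1| + |c.2| ≤ k ∧ (c.1 + c.2 + k) % 2 = 0 := by
  simp only [evenCols, Finset.mem_filter, Finset.mem_product, Finset.mem_Icc, and_iff_right_iff_imp]
  rintro ⟨h, -⟩
  have := abs_nonneg c.1
  have := abs_nonneg c.2
  exact ⟨abs_le.1 (by omega), abs_le.1 (by omega)⟩

theorem mem_oddCols {c : ℤ × ℤ} :
    c ∈ oddCols k ↔ |c.1| + |c.2| + 1 ≤ k ∧ (c.1 + c.2 + k) % 2 = 1 := by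
  simp only [oddCols, Finset.mem_filter, Finset.mem_product, Finset.mem_Icc, and_iff_right_iff_imp]
  rintro ⟨h, -⟩
  have := abs_nonneg c.1
  have := abs_nonneg c.2
  exact ⟨abs_le.1 (by omega), abs_le.1 (by omega)⟩

theorem disjoint_cols (k : ℕ) : Disjoint (oddCols k) (evenCols k) := by
  rw [Finset.disjoint_left]
  intro c hc hc'
  rw [mem_oddCols] at hc
  rw [mem_evenCols] at hc'
  omega

theorem mem_cols_of_colSize {c : ℤ × ℤ} (h : colSize (k + 1) c ≠ 0) :
    c ∈ oddCols k ∪ evenCols k := by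
  rw [Finset.mem_union, mem_oddCols, mem_evenCols]
  unfold colSize at h
  have h1 := abs_choice c.1
  have h2 := abs_choice c.2
  generalize |c.1| = a at *
  generalize |c.2| = b at *
  push_cast at h
  rcases Int.emod_two_eq_zero_or_one (c.1 + c.2 + k) with hp | hp <;> omega

theorem colSize_le_succ (c : ℤ × ℤ) : colSize k c ≤ colSize (k + 1) c := by
  unfold colSize
  push_cast
  omega

theorem colSize_succ_le {c : ℤ × ℤ} (h : c ∈ oddCols k) : colSize (k + 1) c ≤ colSize k c := by
  rw [mem_oddCols] at h
  unfold colSize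
  have h1 := abs_choice c.1
  have h2 := abs_choice c.2
  generalize |c.1| = a at *
  generalize |c.2| = b at *
  push_cast
  omega

/-- The function that agrees with `n` on the columns of `Q_{k+1}` and is zero elsewhere. -/
def restrictOdd (k : ℕ) (n : ℤ × ℤ → ℕ) (c : ℤ × ℤ) : ℕ := if c ∈ oddCols k then n c else 0

/-- The height functions of `P_{k+1}` and of `P_k`, restricted to the columns of `Q_{k+1}`. -/
def oddHeights (k : ℕ) : Finset (ℤ × ℤ → ℕ) := by
  classical exact (heights (k + 1) ∪ heights k).image (restrictOdd k)

theorem eq_zero_of_mem_oddHeights {q : ℤ × ℤ → ℕ} (hq : q ∈ oddHeights k) {c : ℤ × ℤ}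
    (hc : c ∉ oddCols k) : q c = 0 := by
  classical
  simp only [oddHeights, Finset.mem_image] at hq
  obtain ⟨n, -, rfl⟩ := hq
  simp [restrictOdd, hc]

theorem le_colSize_of_mem_oddHeights {q : ℤ × ℤ → ℕ} (hq : q ∈ oddHeights k) (c : ℤ × ℤ) :
    q c ≤ colSize k c := by
  classical
  simp only [oddHeights, Finset.mem_image, Finset.mem_union, mem_heights] at hq
  obtain ⟨n, hn, rfl⟩ := hq
  unfold restrictOdd
  split_ifs with hc
  · rcases hn with hn | hn
    · exact (hn.le_size c).trans (colSize_succ_le hc)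
    · exact hn.le_size c
  · exact Nat.zero_le _

/-- The condition that the neighbouring columns of `c` impose on a height function of `P_{k+1}`
at a column `c` with `r + s ≡ k`. -/
def upperRange (q : ℤ × ℤ → ℕ) (c : ℤ × ℤ) : Finset ℕ :=
  Finset.Icc (max (q (c.1 + 1, c.2)) (q (c.1 - 1, c.2)))
    (min (q (c.1, c.2 + 1) + if |c.2| < |c.2 + 1| then 1 else 0)
      (q (c.1, c.2 - 1) + if |c.2| < |c.2 - 1| then 1 else 0))

/-- The condition that the neighbouring columns of `c` impose on a height function of `P_k`
at a column `c` with `r + s ≡ k`. -/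
def lowerRange (q : ℤ × ℤ → ℕ) (c : ℤ × ℤ) : Finset ℕ :=
  Finset.Icc (max (q (c.1, c.2 + 1) - if |c.2 + 1| < |c.2| then 1 else 0)
      (q (c.1, c.2 - 1) - if |c.2 - 1| < |c.2| then 1 else 0))
    (min (q (c.1 + 1, c.2)) (q (c.1 - 1, c.2)))

theorem eq_of_restrictOdd_eq {K : ℕ} (hK : K ≤ k + 1) {n q : ℤ × ℤ → ℕ} (hn : ∀ c, n c ≤ colSize K c)
    (h : restrictOdd k n = q) {c : ℤ × ℤ} (hc : c ∉ evenCols k) : n c = q c := by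
  rw [← h]
  unfold restrictOdd
  split_ifs with ho
  · rfl
  · by_contra hne
    have h1 : colSize (k + 1) c ≠ 0 := by
      have h2 := hn c
      have h3 : colSize K c ≤ colSize (k + 1) c := by unfold colSize; push_cast; omega
      omega
    have := mem_cols_of_colSize h1
    simp [ho, hc] at this

theorem restrictOdd_eq_of {n q : ℤ × ℤ → ℕ} (hq : q ∈ oddHeights k)
    (h : ∀ c, c ∉ evenCols k → n c = q c) : restrictOdd k n = q := by
  ext c
  unfold restrictOdd
  split_ifs with ho
  · exact h c (Finset.disjoint_left.1 (disjoint_cols k) ho)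
  · exact (eq_zero_of_mem_oddHeights hq ho).symm

theorem eq_add_or_sub {z w : ℤ} (h : |z - w| = 1) : w = z + 1 ∨ w = z - 1 := by
  have := abs_cases (z - w); omega

/-- A height function of `P_{k+1}` with given values on the columns of `Q_{k+1}` is subject to
independent conditions at the remaining columns. -/
theorem isHeight_succ_iff {n q : ℤ × ℤ → ℕ} (hq : q ∈ oddHeights k) :
    (IsHeight (k + 1) n ∧ restrictOdd k n = q) ↔
      (∀ c, c ∉ evenCols k → n c = q c) ∧ ∀ e ∈ evenCols k, n e ∈ upperRange q e := by
  constructor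
  · rintro ⟨hn, h⟩
    have h1 : ∀ c, c ∉ evenCols k → n c = q c := fun c => eq_of_restrictOdd_eq le_rfl hn.le_size h
    refine ⟨h1, fun e he => ?_⟩
    obtain ⟨r, s⟩ := e
    rw [mem_evenCols] at he
    simp only at he
    have e1 : ∀ c : ℤ × ℤ, (c.1 + c.2 + k) % 2 = 1 → n c = q c := fun c hc =>
      h1 c fun hc' => by rw [mem_evenCols] at hc'; omega
    have a1 := hn.le_r (r + 1, s) (r, s) (by push_cast; omega) rfl (by simp)
    have a2 := hn.le_r (r - 1, s) (r, s) (by push_cast; omega) rfl (by simp)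
    have a3 := hn.le_s (r, s) (r, s + 1) (by push_cast; omega) rfl (by simp)
    have a4 := hn.le_s (r, s) (r, s - 1) (by push_cast; omega) rfl (by simp)
    rw [e1 (r + 1, s) (by simp only; omega)] at a1
    rw [e1 (r - 1, s) (by simp only; omega)] at a2
    rw [e1 (r, s + 1) (by simp only; omega)] at a3
    rw [e1 (r, s - 1) (by simp only; omega)] at a4
    simp only [upperRange, Finset.mem_Icc, max_le_iff, le_min_iff]
    exact ⟨⟨a1, a2⟩, a3, a4⟩
  · rintro ⟨h1, h2⟩
    have hz : ∀ c, c ∉ oddCols k → q c = 0 := fun c => eq_zero_of_mem_oddHeights hq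
    refine ⟨⟨fun c => ?_, fun l u hl h3 h4 => ?_, fun u l hu h3 h4 => ?_⟩, restrictOdd_eq_of hq h1⟩
    · by_cases hc : c ∈ evenCols k
      · have h3 := h2 c hc
        obtain ⟨r, s⟩ := c
        simp only [upperRange, Finset.mem_Icc, max_le_iff, le_min_iff] at h3
        have h4 := le_colSize_of_mem_oddHeights hq (r, s + 1)
        have h5 := le_colSize_of_mem_oddHeights hq (r, s - 1)
        have h6 := abs_cases s
        have h7 := abs_cases (s + 1)
        have h8 := abs_cases (s - 1)
        have hp := (mem_evenCols.1 hc).1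
        unfold colSize at *
        simp only at h3 h4 h5 hp ⊢
        generalize |r| = a at *
        generalize |s| = b at *
        generalize |s + 1| = b1 at *
        generalize |s - 1| = b2 at *
        push_cast
        rcases h6 with h6 | h6
        · rw [if_pos (show b < b1 by omega)] at h3
          omega
        · rw [if_pos (show b < b2 by omega)] at h3
          omega
      · rw [h1 c hc]
        exact (le_colSize_of_mem_oddHeights hq c).trans (colSize_le_succ c)
    · have hle : l ∉ evenCols k := fun h => by rw [mem_evenCols] at h; push_cast at hl; omega
      rw [h1 l hle]
      by_cases hu : u ∈ evenCols k
      · have h5 := h2 u hu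
        simp only [upperRange, Finset.mem_Icc, max_le_iff, le_min_iff] at h5
        obtain ⟨r, s⟩ := u
        obtain ⟨r', s'⟩ := l
        simp only at h3 h4 h5
        subst h3
        rw [abs_sub_comm] at h4
        rcases eq_add_or_sub h4 with rfl | rfl
        · exact h5.1.1
        · exact h5.1.2
      · rw [hz l]
        · exact Nat.zero_le _
        · intro hl'
          rw [mem_oddCols] at hl'
          rw [mem_evenCols] at hu
          apply hu
          rw [h3]
          have := abs_sub_abs_le_abs_sub u.1 l.1
          rw [abs_sub_comm] at this
          have := abs_cases (l.1 - u.1)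
          omega
    · have hle : l ∉ evenCols k := fun h => by
        have := abs_cases (u.2 - l.2)
        rw [mem_evenCols] at h; push_cast at hu; omega
      rw [h1 l hle]
      by_cases hue : u ∈ evenCols k
      · have h5 := h2 u hue
        simp only [upperRange, Finset.mem_Icc, max_le_iff, le_min_iff] at h5
        obtain ⟨r, s⟩ := u
        obtain ⟨r', s'⟩ := l
        simp only at h3 h4 h5 ⊢
        subst h3
        rcases eq_add_or_sub h4 with rfl | rfl
        · exact h5.2.1
        · exact h5.2.2
      · rw [h1 u hue, hz u]
        · exact Nat.zero_le _
        · intro h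
          rw [mem_oddCols] at h
          push_cast at hu
          omega

/-- A height function of `P_k` with given values on the columns of `Q_{k+1}` is subject to
independent conditions at the remaining columns. -/
theorem isHeight_iff {n q : ℤ × ℤ → ℕ} (hq : q ∈ oddHeights k) :
    (IsHeight k n ∧ restrictOdd k n = q) ↔
      (∀ c, c ∉ evenCols k → n c = q c) ∧ ∀ e ∈ evenCols k, n e ∈ lowerRange q e := by
  constructor
  · rintro ⟨hn, h⟩
    have h1 : ∀ c, c ∉ evenCols k → n c = q c := fun c =>
      eq_of_restrictOdd_eq (Nat.le_succ k) hn.le_size h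
    refine ⟨h1, fun e he => ?_⟩
    obtain ⟨r, s⟩ := e
    rw [mem_evenCols] at he
    simp only at he
    have e1 : ∀ c : ℤ × ℤ, (c.1 + c.2 + k) % 2 = 1 → n c = q c := fun c hc =>
      h1 c fun hc' => by rw [mem_evenCols] at hc'; omega
    have a1 := hn.le_r (r, s) (r + 1, s) (by simp only; omega) rfl (by simp)
    have a2 := hn.le_r (r, s) (r - 1, s) (by simp only; omega) rfl (by simp)
    have a3 := hn.le_s (r, s + 1) (r, s) (by simp only; omega) rfl (by simp)
    have a4 := hn.le_s (r, s - 1) (r, s) (by simp only; omega) rfl (by simp)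
    rw [e1 (r + 1, s) (by simp only; omega)] at a1
    rw [e1 (r - 1, s) (by simp only; omega)] at a2
    rw [e1 (r, s + 1) (by simp only; omega)] at a3
    rw [e1 (r, s - 1) (by simp only; omega)] at a4
    simp only [lowerRange, Finset.mem_Icc, max_le_iff, le_min_iff, tsub_le_iff_right]
    exact ⟨⟨a3, a4⟩, a1, a2⟩
  · rintro ⟨h1, h2⟩
    have hz : ∀ c, c ∉ oddCols k → q c = 0 := fun c => eq_zero_of_mem_oddHeights hq
    refine ⟨⟨fun c => ?_, fun l u hl h3 h4 => ?_, fun u l hu h3 h4 => ?_⟩, restrictOdd_eq_of hq h1⟩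
    · by_cases hc : c ∈ evenCols k
      · have h3 := h2 c hc
        obtain ⟨r, s⟩ := c
        simp only [lowerRange, Finset.mem_Icc, max_le_iff, le_min_iff] at h3
        have h4 := le_colSize_of_mem_oddHeights hq (r + 1, s)
        have h5 := le_colSize_of_mem_oddHeights hq (r - 1, s)
        have h6 := abs_cases r
        have h7 := abs_cases (r + 1)
        have h8 := abs_cases (r - 1)
        have hp := (mem_evenCols.1 hc).1
        unfold colSize at *
        simp only at h3 h4 h5 hp ⊢
        generalize |r| = a at *
        generalize |s| = b at *
        generalize |r + 1| = b1 at *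
        generalize |r - 1| = b2 at *
        omega
      · rw [h1 c hc]
        exact le_colSize_of_mem_oddHeights hq c
    · have hue : u ∉ evenCols k := fun h => by
        have := abs_cases (l.1 - u.1)
        rw [mem_evenCols] at h; omega
      rw [h1 u hue]
      by_cases hle : l ∈ evenCols k
      · have h5 := h2 l hle
        simp only [lowerRange, Finset.mem_Icc, max_le_iff, le_min_iff] at h5
        obtain ⟨r, s⟩ := l
        obtain ⟨r', s'⟩ := u
        simp only at h3 h4 h5
        subst h3
        rcases eq_add_or_sub h4 with rfl | rfl
        · exact h5.2.1
        · exact h5.2.2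
      · rw [h1 l hle, hz l]
        · exact Nat.zero_le _
        · intro h
          rw [mem_oddCols] at h
          omega
    · have hue : u ∉ evenCols k := fun h => by rw [mem_evenCols] at h; omega
      rw [h1 u hue]
      by_cases hle : l ∈ evenCols k
      · have h5 := h2 l hle
        simp only [lowerRange, Finset.mem_Icc, max_le_iff, le_min_iff, tsub_le_iff_right] at h5
        obtain ⟨r, s⟩ := l
        obtain ⟨r', s'⟩ := u
        simp only at h3 h4 h5 ⊢
        subst h3
        rw [abs_sub_comm] at h4
        rcases eq_add_or_sub h4 with rfl | rfl
        · exact h5.1.1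
        · exact h5.1.2
      · rw [hz u]
        · exact Nat.zero_le _
        · intro hu'
          rw [mem_oddCols] at hu'
          rw [mem_evenCols] at hle
          apply hle
          rw [h3]
          have := abs_sub_abs_le_abs_sub l.2 u.2
          rw [abs_sub_comm] at this
          have := abs_cases (u.2 - l.2)
          omega

/-- `F` for `P_{k+1}`, summed column by column over the columns outside `Q_{k+1}`. -/
theorem F_succ_eq (y : ℤ → ℝ) (j : ℤ) (k : ℕ) :
    F y j (k + 1) = ∑ q ∈ oddHeights k, (∏ o ∈ oddCols k, y (3 * o.1 + o.2 + j) ^ q o) *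
      ∏ e ∈ evenCols k, ∑ i ∈ upperRange q e, y (3 * e.1 + e.2 + j) ^ i := by
  classical
  rw [F_eq_sum_heights y j (k + 1) _ fun c => mem_cols_of_colSize,
    ← Finset.sum_fiberwise_of_maps_to (t := oddHeights k) (g := restrictOdd k)
      (fun n hn => by
        simp only [oddHeights]
        exact Finset.mem_image_of_mem _ (Finset.mem_union_left _ hn))]
  refine Finset.sum_congr rfl fun q hq => ?_
  rw [← sum_prod_eq_prod_sum (evenCols k) q (upperRange q)
    ((heights (k + 1)).filter fun n => restrictOdd k n = q)
    (fun n => by rw [Finset.mem_filter, mem_heights, isHeight_succ_iff hq]), Finset.mul_sum]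
  refine Finset.sum_congr rfl fun n hn => ?_
  rw [Finset.mem_filter, mem_heights, isHeight_succ_iff hq] at hn
  rw [Finset.prod_union (disjoint_cols k)]
  congr 1
  refine Finset.prod_congr rfl fun o ho => ?_
  rw [hn.1 o (Finset.disjoint_left.1 (disjoint_cols k) ho)]

/-- `F` for `P_k`, summed column by column over the columns outside `Q_{k+1}`. -/
theorem F_eq (y : ℤ → ℝ) (j : ℤ) (k : ℕ) :
    F y j k = ∑ q ∈ oddHeights k, (∏ o ∈ oddCols k, y (3 * o.1 + o.2 + j) ^ q o) *
      ∏ e ∈ evenCols k, ∑ i ∈ lowerRange q e, y (3 * e.1 + e.2 + j) ^ i := by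
  classical
  rw [F_eq_sum_heights y j k _ fun c hc => mem_cols_of_colSize (k := k) (by
      have := colSize_le_succ (k := k) c; omega),
    ← Finset.sum_fiberwise_of_maps_to (t := oddHeights k) (g := restrictOdd k)
      (fun n hn => by
        simp only [oddHeights]
        exact Finset.mem_image_of_mem _ (Finset.mem_union_right _ hn))]
  refine Finset.sum_congr rfl fun q hq => ?_
  rw [← sum_prod_eq_prod_sum (evenCols k) q (lowerRange q)
    ((heights k).filter fun n => restrictOdd k n = q)
    (fun n => by rw [Finset.mem_filter, mem_heights, isHeight_iff hq]), Finset.mul_sum]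
  refine Finset.sum_congr rfl fun n hn => ?_
  rw [Finset.mem_filter, mem_heights, isHeight_iff hq] at hn
  rw [Finset.prod_union (disjoint_cols k)]
  congr 1
  refine Finset.prod_congr rfl fun o ho => ?_
  rw [hn.1 o (Finset.disjoint_left.1 (disjoint_cols k) ho)]

/-! ### Mutation of the polynomials `F` -/

/-- The identity behind the mutation of `F`, at a single column: `n₁`, `n₂` are the heights of the
neighbouring columns in the `r`-direction, `m₁`, `m₂` the upper bounds that come from those in the
`s`-direction.  Each of the intervals has at most two elements. -/
theorem sum_Icc_max_min {z : ℝ} (hz : z ≠ 0) (m₁ m₂ n₁ n₂ : ℕ)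
    (h11 : m₁ ≤ n₁ + 1) (h12 : m₁ ≤ n₂ + 1) (h21 : m₂ ≤ n₁ + 1) (h22 : m₂ ≤ n₂ + 1)
    (h11' : n₁ ≤ m₁) (h12' : n₂ ≤ m₁) (h21' : n₁ ≤ m₂) (h22' : n₂ ≤ m₂) (h0 : 1 ≤ max m₁ m₂) :
    (∑ i ∈ Finset.Icc (max n₁ n₂) (min m₁ m₂), z ^ i) * (1 + z) ^ (n₁ + n₂ + 1) =
      z ^ (n₁ + n₂) * (1 + z) ^ (m₁ + m₂) *
        ∑ i ∈ Finset.Icc (max (m₁ - 1) (m₂ - 1)) (min n₁ n₂), (z ^ i)⁻¹ := by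
  have hpair : ∀ (p : ℕ) (f : ℕ → ℝ), ∑ i ∈ Finset.Icc p (p + 1), f i = f p + f (p + 1) := by
    intro p f
    rw [Finset.sum_Icc_succ_top (by omega), Finset.Icc_self, Finset.sum_singleton]
  rcases lt_trichotomy m₁ m₂ with h | h | h
  · obtain rfl : n₁ = m₁ := by omega
    obtain rfl : n₂ = n₁ := by omega
    obtain rfl : m₂ = n₂ + 1 := by omega
    simp only [max_self, min_self, Nat.le_add_right, min_eq_left, Nat.add_sub_cancel,
      max_eq_right (Nat.sub_le n₂ 1), Finset.Icc_self, Finset.sum_singleton]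
    field_simp
    ring
  · subst h
    obtain ⟨p, rfl⟩ : ∃ p, m₁ = p + 1 := ⟨m₁ - 1, by omega⟩
    obtain rfl | rfl : n₁ = p ∨ n₁ = p + 1 := by omega
    · obtain rfl | rfl : n₂ = n₁ ∨ n₂ = n₁ + 1 := by omega
      · simp only [max_self, min_self, Nat.add_sub_cancel, Finset.Icc_self, Finset.sum_singleton,
          hpair]
        field_simp
        ring
      · simp only [max_self, min_self, Nat.add_sub_cancel, Nat.le_add_right, max_eq_right,
          min_eq_left, Finset.Icc_self, Finset.sum_singleton]
        field_simp
        ring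
    · obtain rfl | rfl : n₂ = p ∨ n₂ = p + 1 := by omega
      · simp only [max_self, min_self, Nat.add_sub_cancel, Nat.le_add_right, max_eq_left,
          min_eq_right, Finset.Icc_self, Finset.sum_singleton]
        field_simp
        ring
      · simp only [max_self, min_self, Nat.add_sub_cancel, Finset.Icc_self, Finset.sum_singleton,
          hpair]
        field_simp
        ring
  · obtain rfl : n₁ = m₂ := by omega
    obtain rfl : n₂ = n₁ := by omega
    obtain rfl : m₁ = n₂ + 1 := by omega
    simp only [max_self, min_self, Nat.le_add_right, min_eq_right, Nat.add_sub_cancel,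
      max_eq_left (Nat.sub_le n₂ 1), Finset.Icc_self, Finset.sum_singleton]
    field_simp
    ring

/-- If all the ranges are nonempty, for `P_{k+1}` or for `P_k`, then the heights of two columns next
to `(r, s)`, one in each direction, determine each other up to one.  In the other case both products
of sums in `F_succ_eq` and `F_eq` vanish. -/
theorem neighbours_le {q : ℤ × ℤ → ℕ} (hq : q ∈ oddHeights k)
    (h : (∀ e ∈ evenCols k, (upperRange q e).Nonempty) ∨
      (∀ e ∈ evenCols k, (lowerRange q e).Nonempty))
    {r s r' s' : ℤ} (he : (r, s) ∈ evenCols k) (hr : |r - r'| = 1) (hs : |s - s'| = 1) :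
    q (r, s') + (if |s| < |s'| then 1 else 0) ≤ q (r', s) + 1 ∧
      q (r', s) ≤ q (r, s') + if |s| < |s'| then 1 else 0 := by
  have hz : ∀ c, c ∉ oddCols k → q c = 0 := fun c => eq_zero_of_mem_oddHeights hq
  have hs0 : s ≠ s' := by rintro rfl; simp at hs
  have hr1 := eq_add_or_sub hr
  have hs1 := eq_add_or_sub hs
  have habs : |s| < |s'| ∨ |s'| < |s| := by
    have := abs_cases s
    have := abs_cases s'
    omega
  have hopp : (if |s'| < |s| then 1 else 0) + (if |s| < |s'| then 1 else 0) = 1 := by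
    rcases habs with h | h <;> simp [h, not_lt.2 h.le]
  have hup : ∀ a b a' b' : ℤ, |a - a'| = 1 → |b - b'| = 1 → (upperRange q (a, b)).Nonempty →
      q (a', b) ≤ q (a, b') + if |b| < |b'| then 1 else 0 := by
    intro a b a' b' ha hb hne
    simp only [upperRange, Finset.nonempty_Icc, max_le_iff, le_min_iff] at hne
    rcases eq_add_or_sub ha with rfl | rfl <;> rcases eq_add_or_sub hb with rfl | rfl
    exacts [hne.1.1, hne.2.1, hne.1.2, hne.2.2]
  have hlo : ∀ a b a' b' : ℤ, |a - a'| = 1 → |b - b'| = 1 → (lowerRange q (a, b)).Nonempty →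
      q (a, b') ≤ q (a', b) + if |b'| < |b| then 1 else 0 := by
    intro a b a' b' ha hb hne
    simp only [lowerRange, Finset.nonempty_Icc, max_le_iff, le_min_iff, tsub_le_iff_right] at hne
    rcases eq_add_or_sub ha with rfl | rfl <;> rcases eq_add_or_sub hb with rfl | rfl
    exacts [hne.1.1, hne.1.2, hne.2.1, hne.2.2]
  -- The columns `(r, s')` and `(r', s)` are neighbours of `(r, s)` and of `(r', s')`, with the
  -- roles of the two directions exchanged; each of the two columns gives one of the inequalities.
  have hfar : (r', s') ∉ evenCols k → q (r, s') = 0 ∧ q (r', s) = 0 := by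
    intro hfar
    constructor
    all_goals
      refine hz _ fun ho => hfar ?_
      rw [mem_oddCols] at ho
      rw [mem_evenCols] at he ⊢
      have := abs_cases r
      have := abs_cases r'
      have := abs_cases s
      have := abs_cases s'
      simp only at *
      omega
  rw [abs_sub_comm] at hr hs
  rcases h with h | h
  · have h1 := hup r s r' s' (by rwa [abs_sub_comm]) (by rwa [abs_sub_comm]) (h _ he)
    refine ⟨?_, h1⟩
    by_cases hfe : (r', s') ∈ evenCols k
    · have h2 := hup r' s' r s hr hs (h _ hfe)
      omega
    · rw [(hfar hfe).1]
      omega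
  · have h1 := hlo r s r' s' (by rwa [abs_sub_comm]) (by rwa [abs_sub_comm]) (h _ he)
    refine ⟨by omega, ?_⟩
    by_cases hfe : (r', s') ∈ evenCols k
    · exact hlo r' s' r s hr hs (h _ hfe)
    · rw [(hfar hfe).2]
      omega

/-- The sum over the heights of one column for `P_{k+1}` in terms of the corresponding sum for `P_k`
with the inverse variable.  The powers in the middle are those that the mutation attaches to the
variables of the four neighbouring columns. -/
theorem sum_upperRange {q : ℤ × ℤ → ℕ} (hq : q ∈ oddHeights k)
    (h : (∀ e ∈ evenCols k, (upperRange q e).Nonempty) ∨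
      (∀ e ∈ evenCols k, (lowerRange q e).Nonempty))
    {e : ℤ × ℤ} (he : e ∈ evenCols k) {z : ℝ} (hz : z ≠ 0) (hz1 : 1 + z ≠ 0) :
    ∑ i ∈ upperRange q e, z ^ i = (if e.2 = 0 then 1 + z else 1) *
      ((z / (1 + z)) ^ q (e.1 + 1, e.2) * (z / (1 + z)) ^ q (e.1 - 1, e.2) *
        ((1 + z) ^ q (e.1, e.2 + 1) * (1 + z) ^ q (e.1, e.2 - 1))) *
      ∑ i ∈ lowerRange q e, z⁻¹ ^ i := by
  obtain ⟨r, s⟩ := e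
  have hD := fun r' s' => neighbours_le (r' := r') (s' := s') hq h he
  have a1 := hD (r + 1) (s + 1) (by simp) (by simp)
  have a2 := hD (r + 1) (s - 1) (by simp) (by simp)
  have a3 := hD (r - 1) (s + 1) (by simp) (by simp)
  have a4 := hD (r - 1) (s - 1) (by simp) (by simp)
  have b1 := abs_cases s
  have b2 := abs_cases (s + 1)
  have b3 := abs_cases (s - 1)
  have c1 : (if |s + 1| < |s| then 1 else 0) = 1 - (if |s| < |s + 1| then 1 else 0) := by
    split_ifs <;> omega
  have c2 : (if |s - 1| < |s| then 1 else 0) = 1 - (if |s| < |s - 1| then 1 else 0) := by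
    split_ifs <;> omega
  obtain ⟨u, hu⟩ : ∃ u, (if |s| < |s + 1| then 1 else 0) = u := ⟨_, rfl⟩
  obtain ⟨v, hv⟩ : ∃ v, (if |s| < |s - 1| then 1 else 0) = v := ⟨_, rfl⟩
  have huv : u + v = if s = 0 then 2 else 1 := by
    rw [← hu, ← hv]
    split_ifs <;> omega
  have hu1 : u ≤ 1 := by rw [← hu]; split_ifs <;> omega
  have hv1 : v ≤ 1 := by rw [← hv]; split_ifs <;> omega
  simp only [upperRange, lowerRange, c1, c2]
  rw [hu, hv]
  rw [hu] at a1 a3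
  rw [hv] at a2 a4
  generalize q (r + 1, s) = n₁ at *
  generalize q (r - 1, s) = n₂ at *
  generalize q (r, s + 1) = n₃ at *
  generalize q (r, s - 1) = n₄ at *
  have huv1 : 1 ≤ u + v := by rw [huv]; split_ifs <;> omega
  have key := sum_Icc_max_min hz (n₃ + u) (n₄ + v) n₁ n₂ a1.1 a3.1 a2.1 a4.1 a1.2 a3.2 a2.2 a4.2
    (by omega)
  have d1 : n₃ - (1 - u) = n₃ + u - 1 := by omega
  have d2 : n₄ - (1 - v) = n₄ + v - 1 := by omega
  have hw : (1 + z) ^ (u + v) = (if s = 0 then 1 + z else 1) * (1 + z) := by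
    rw [huv]
    split_ifs <;> ring
  rw [d1, d2]
  have e1 : (1 + z) ^ (n₃ + u + (n₄ + v)) =
      (1 + z) ^ n₃ * (1 + z) ^ n₄ * ((if s = 0 then 1 + z else 1) * (1 + z)) := by
    rw [← hw]; ring
  rw [e1] at key
  simp only [inv_pow]
  generalize (∑ i ∈ Finset.Icc (max (n₃ + u - 1) (n₄ + v - 1)) (min n₁ n₂), (z ^ i)⁻¹) = S' at *
  generalize (if s = 0 then 1 + z else (1 : ℝ)) = w at *
  have hne : (1 + z) ^ (n₁ + n₂ + 1) ≠ 0 := pow_ne_zero _ hz1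
  rw [← mul_left_inj' hne, key, div_pow, div_pow]
  field_simp
  ring

/-- Collecting the powers by the neighbour in a fixed direction; columns outside `oddCols k`
contribute trivial powers. -/
theorem prod_evenCols_pow_shift {q : ℤ × ℤ → ℕ} (hq : q ∈ oddHeights k) (g : ℤ × ℤ → ℝ)
    (d : ℤ × ℤ) (hd : |d.1| + |d.2| = 1) :
    ∏ e ∈ evenCols k, g e ^ q (e.1 + d.1, e.2 + d.2) =
      ∏ o ∈ oddCols k, g (o.1 - d.1, o.2 - d.2) ^ q o := by
  have hz : ∀ c, c ∉ oddCols k → q c = 0 := fun c => eq_zero_of_mem_oddHeights hq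
  have h1 := abs_cases d.1
  have h2 := abs_cases d.2
  symm
  refine Finset.prod_bij_ne_one (fun o _ _ => (o.1 - d.1, o.2 - d.2)) ?_ ?_ ?_ ?_
  · intro o ho _
    rw [mem_oddCols] at ho
    rw [mem_evenCols]
    have := abs_sub o.1 d.1
    have := abs_sub o.2 d.2
    simp only at *
    omega
  · rintro ⟨r, s⟩ _ _ ⟨r', s'⟩ _ _ h
    simp only [Prod.mk.injEq] at h ⊢
    omega
  · rintro ⟨r, s⟩ he hne
    refine ⟨(r + d.1, s + d.2), ?_, ?_, by simp⟩
    · by_contra hc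
      simp [hz _ hc] at hne
    · simpa using hne
  · rintro ⟨r, s⟩ _ _
    simp

/-- The columns in `evenCols k` with `s = 0` are those with `r = -k, -k + 2, …, k`. -/
theorem prod_axis (k : ℕ) (g : ℤ × ℤ → ℝ) :
    ∏ e ∈ evenCols k, (if e.2 = 0 then g e else 1) =
      ∏ a ∈ Finset.range (k + 1), g (2 * (a : ℤ) - k, 0) := by
  rw [← Finset.prod_filter]
  symm
  refine Finset.prod_bij (fun a _ => (2 * (a : ℤ) - k, 0)) ?_ ?_ ?_ ?_
  · intro a ha
    rw [Finset.mem_range] at ha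
    have := abs_cases (2 * (a : ℤ) - k)
    simp only [Finset.mem_filter, mem_evenCols, abs_zero, and_true]
    omega
  · intro a _ b _ h
    simp only [Prod.mk.injEq] at h
    omega
  · rintro ⟨r, s⟩ h
    simp only [Finset.mem_filter, mem_evenCols] at h
    obtain ⟨⟨h1, h2⟩, rfl⟩ := h
    rw [abs_zero] at h1
    have := abs_cases r
    refine ⟨((r + k) / 2).toNat, ?_, ?_⟩
    · rw [Finset.mem_range]
      omega
    · simp only [Prod.mk.injEq, and_true]
      omega
  · intros
    rfl

end Columns

/-- The transformation of `y`-parameters under the pentagram map: those at the vertices, which are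
the `y i` with `i + p` even, and those on the edges change in different ways.  The nonvanishing of
all the quantities that are inverted is part of the notion. -/
structure IsMutation (p : ℤ) (y y' : ℤ → ℝ) : Prop where
  ne_zero : ∀ i, y i ≠ 0
  one_add_ne_zero : ∀ i, Even (i + p) → 1 + y i ≠ 0
  even : ∀ i, Even (i + p) → y' i = (y i)⁻¹
  odd : ∀ i, Odd (i + p) → y' i = y (i - 3) * y i * y (i + 3) *
    ((1 + y (i - 1)) * (1 + y (i + 1)) / ((1 + y (i - 3)) * (1 + y (i + 3))))

/-- The factor by which `F` changes under a mutation. -/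
def mutationFactor (y : ℤ → ℝ) (j : ℤ) (k : ℕ) : ℝ :=
  ∏ a ∈ Finset.range (k + 1), (1 + y (3 * (2 * (a : ℤ) - k) + j))

theorem IsMutation.mutationFactor_ne_zero {p : ℤ} {y y' : ℤ → ℝ} (h : IsMutation p y y') {j : ℤ}
    {k : ℕ} (hj : Even (j + k + p)) : mutationFactor y j k ≠ 0 := by
  refine Finset.prod_ne_zero_iff.2 fun a _ => h.one_add_ne_zero _ ?_
  rw [Int.even_iff] at *
  omega

/-- Both sides are sums over the common part `Q_{k+1}` of order ideals of `P_{k+1}` and `P_k`;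
for a fixed common part the terms agree. -/
theorem IsMutation.F_succ {p : ℤ} {y y' : ℤ → ℝ} (h : IsMutation p y y') {j : ℤ} {k : ℕ}
    (hj : Even (j + k + p)) : F y j (k + 1) = mutationFactor y j k * F y' j k := by
  rw [F_succ_eq, F_eq, Finset.mul_sum]
  refine Finset.sum_congr rfl fun q hq => ?_
  have heven : ∀ e ∈ evenCols k, Even (3 * e.1 + e.2 + j + p) := fun e he => by
    rw [mem_evenCols] at he
    rw [Int.even_iff] at *
    omega
  have hodd : ∀ o ∈ oddCols k, Odd (3 * o.1 + o.2 + j + p) := fun e he => by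
    rw [mem_oddCols] at he
    rw [Int.even_iff] at hj
    rw [Int.odd_iff]
    omega
  by_cases hne : (∀ e ∈ evenCols k, (upperRange q e).Nonempty) ∨
      (∀ e ∈ evenCols k, (lowerRange q e).Nonempty)
  · set Y : ℤ × ℤ → ℝ := fun c => y (3 * c.1 + c.2 + j) with hY
    have h1 : ∏ e ∈ evenCols k, ∑ i ∈ upperRange q e, y (3 * e.1 + e.2 + j) ^ i =
        mutationFactor y j k * (∏ o ∈ oddCols k,
          ((Y (o.1 - 1, o.2) / (1 + Y (o.1 - 1, o.2))) ^ q o *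
            (Y (o.1 + 1, o.2) / (1 + Y (o.1 + 1, o.2))) ^ q o *
          ((1 + Y (o.1, o.2 - 1)) ^ q o * (1 + Y (o.1, o.2 + 1)) ^ q o))) *
        ∏ e ∈ evenCols k, ∑ i ∈ lowerRange q e, y' (3 * e.1 + e.2 + j) ^ i := by
      rw [Finset.prod_congr rfl fun e he => sum_upperRange hq hne he (h.ne_zero _)
        (h.one_add_ne_zero _ (heven e he)), Finset.prod_mul_distrib, Finset.prod_mul_distrib,
        prod_axis k fun e => 1 + y (3 * e.1 + e.2 + j)]
      congr 1
      · congr 1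
        · unfold mutationFactor
          simp
        · simp only [Finset.prod_mul_distrib]
          have s1 := prod_evenCols_pow_shift hq (fun c => Y c / (1 + Y c)) (1, 0) (by simp)
          have s2 := prod_evenCols_pow_shift hq (fun c => Y c / (1 + Y c)) (-1, 0) (by simp)
          have s3 := prod_evenCols_pow_shift hq (fun c => 1 + Y c) (0, 1) (by simp)
          have s4 := prod_evenCols_pow_shift hq (fun c => 1 + Y c) (0, -1) (by simp)
          simp only [add_zero, sub_zero, ← sub_eq_add_neg, sub_neg_eq_add] at s1 s2 s3 s4
          rw [← s1, ← s2, ← s3, ← s4]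
      · refine Finset.prod_congr rfl fun e he => ?_
        rw [h.even _ (heven e he)]
    have h2 : (∏ o ∈ oddCols k, y' (3 * o.1 + o.2 + j) ^ q o) =
        (∏ o ∈ oddCols k, y (3 * o.1 + o.2 + j) ^ q o) * ∏ o ∈ oddCols k,
          ((Y (o.1 - 1, o.2) / (1 + Y (o.1 - 1, o.2))) ^ q o *
            (Y (o.1 + 1, o.2) / (1 + Y (o.1 + 1, o.2))) ^ q o *
          ((1 + Y (o.1, o.2 - 1)) ^ q o * (1 + Y (o.1, o.2 + 1)) ^ q o)) := by
      rw [← Finset.prod_mul_distrib]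
      refine Finset.prod_congr rfl fun o ho => ?_
      rw [h.odd _ (hodd o ho), ← mul_pow, ← mul_pow, ← mul_pow, ← mul_pow]
      congr 1
      have i1 : 3 * (o.1 - 1) + o.2 + j = 3 * o.1 + o.2 + j - 3 := by ring
      have i2 : 3 * (o.1 + 1) + o.2 + j = 3 * o.1 + o.2 + j + 3 := by ring
      have i3 : 3 * o.1 + (o.2 - 1) + j = 3 * o.1 + o.2 + j - 1 := by ring
      have i4 : 3 * o.1 + (o.2 + 1) + j = 3 * o.1 + o.2 + j + 1 := by ring
      simp only [hY, i1, i2, i3, i4, div_eq_mul_inv, mul_inv]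
      ring
    rw [h1, h2]
    ring
  · rw [not_or] at hne
    obtain ⟨h1, h2⟩ := hne
    push Not at h1 h2
    obtain ⟨e, he, h1⟩ := h1
    obtain ⟨e', he', h2⟩ := h2
    rw [Finset.prod_eq_zero he (by simp [h1]), Finset.prod_eq_zero he' (by simp [h2])]
    simp

/-! ### The formula for iterated mutations -/

theorem F_zero (y : ℤ → ℝ) (j : ℤ) : F y j 0 = 1 := by
  have h0 : ∀ c, colSize 0 c = 0 := fun c => by
    unfold colSize
    have := abs_nonneg c.1
    have := abs_nonneg c.2
    push_cast
    omega
  have h : heights 0 = {0} := by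
    ext n
    rw [mem_heights, Finset.mem_singleton]
    constructor
    · intro hn
      ext c
      have := hn.le_size c
      simpa [h0] using this
    · rintro rfl
      exact ⟨by simp, by simp, by simp⟩
  rw [F_eq_sum_heights y j 0 ∅ fun c hc => absurd (h0 c) hc, h]
  simp

theorem prod_range_two_mul_add_one (g : ℕ → ℝ) (k : ℕ) :
    ∏ b ∈ Finset.range (2 * k + 1), g b =
      (∏ a ∈ Finset.range (k + 1), g (2 * a)) * ∏ a ∈ Finset.range k, g (2 * a + 1) := by
  induction k with
  | zero => simp
  | succ k ih =>
    rw [show 2 * (k + 1) + 1 = 2 * k + 1 + 1 + 1 by ring, Finset.prod_range_succ,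
      Finset.prod_range_succ, ih, Finset.prod_range_succ (fun a => g (2 * a)) (k + 1),
      Finset.prod_range_succ (fun a => g (2 * a + 1)) k,
      show 2 * (k + 1) = 2 * k + 1 + 1 by ring]
    ring

theorem prod_Icc_eq (f : ℤ → ℝ) (k : ℕ) :
    ∏ i ∈ Finset.Icc (-(k : ℤ)) k, f i =
      (∏ a ∈ Finset.range (k + 1), f (2 * (a : ℤ) - k)) *
        ∏ a ∈ Finset.range k, f (2 * (a : ℤ) + 1 - k) := by
  have h := prod_range_two_mul_add_one (fun b => f ((b : ℤ) - k)) k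
  push_cast at h
  rw [← h]
  symm
  refine Finset.prod_bij (fun b _ => (b : ℤ) - k) ?_ ?_ ?_ ?_
  · intro b hb
    rw [Finset.mem_range] at hb
    rw [Finset.mem_Icc]
    omega
  · intro a _ b _ hab
    omega
  · intro i hi
    rw [Finset.mem_Icc] at hi
    exact ⟨(i + k).toNat, by rw [Finset.mem_range]; omega, by omega⟩
  · intros
    rfl

/-- In the product of `y'` over the progression, the new parameters alternate between the two
kinds; the inverses cancel the parameters that the others produce twice. -/
theorem IsMutation.prod_Icc {p : ℤ} {y y' : ℤ → ℝ} (h : IsMutation p y y') {j : ℤ} {k : ℕ}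
    (hj : Even (j + (k + 1) + p)) :
    ∏ i ∈ Finset.Icc (-(k : ℤ)) k, y' (j + 3 * i) =
      (∏ i ∈ Finset.Icc (-((k + 1 : ℕ) : ℤ)) (k + 1 : ℕ), y (j + 3 * i)) *
        (mutationFactor y (j - 1) k * mutationFactor y (j + 1) k /
          (mutationFactor y (j - 3) k * mutationFactor y (j + 3) k)) := by
  rw [Int.even_iff] at hj
  set f : ℤ → ℝ := fun i => y (j + 3 * i) with hf
  have hf0 : ∀ i, f i ≠ 0 := fun i => h.ne_zero _
  have h1 : ∏ a ∈ Finset.range (k + 1), y' (j + 3 * (2 * (a : ℤ) - k)) =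
      (∏ a ∈ Finset.range (k + 1), f (2 * (a : ℤ) - (k + 1))) *
      (∏ a ∈ Finset.range (k + 1), f (2 * (a : ℤ) - k)) *
      (∏ a ∈ Finset.range (k + 1), f (2 * ((a + 1 : ℕ) : ℤ) - (k + 1))) *
        (mutationFactor y (j - 1) k * mutationFactor y (j + 1) k /
          (mutationFactor y (j - 3) k * mutationFactor y (j + 3) k)) := by
    unfold mutationFactor
    simp only [← Finset.prod_mul_distrib, ← Finset.prod_div_distrib]
    refine Finset.prod_congr rfl fun a _ => ?_
    rw [h.odd _ (by rw [Int.odd_iff]; omega)]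
    push_cast
    simp only [hf]
    ring_nf
  have h2 : ∏ a ∈ Finset.range k, y' (j + 3 * (2 * (a : ℤ) + 1 - k)) =
      (∏ a ∈ Finset.range k, f (2 * (a : ℤ) + 1 - k))⁻¹ := by
    rw [← Finset.prod_inv_distrib]
    exact Finset.prod_congr rfl fun a _ => h.even _ (by rw [Int.even_iff]; omega)
  have h3 : ∏ a ∈ Finset.range k, f (2 * ((a + 1 : ℕ) : ℤ) - (k + 1)) =
      ∏ a ∈ Finset.range k, f (2 * (a : ℤ) + 1 - k) :=
    Finset.prod_congr rfl fun a _ => by congr 1; push_cast; ring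
  have h4 : ∏ a ∈ Finset.range (k + 1), f (2 * (a : ℤ) + 1 - (k + 1)) =
      ∏ a ∈ Finset.range (k + 1), f (2 * (a : ℤ) - k) :=
    Finset.prod_congr rfl fun a _ => by congr 1; ring
  have h5 : ∏ a ∈ Finset.range k, f (2 * (a : ℤ) + 1 - k) ≠ 0 :=
    Finset.prod_ne_zero_iff.2 fun a _ => hf0 _
  rw [prod_Icc_eq (fun i => y' (j + 3 * i)) k, prod_Icc_eq f (k + 1), h1, h2]
  rw [Finset.prod_range_succ (fun a => f (2 * ((a + 1 : ℕ) : ℤ) - (k + 1))) k, h3,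
    Finset.prod_range_succ (fun a => f (2 * (a : ℤ) - ((k + 1 : ℕ) : ℤ))) (k + 1)]
  push_cast at h4 ⊢
  rw [h4]
  field_simp

/-- All the polynomials that occur in the denominators have an odd sum `j + k + p`. -/
theorem F_ne_zero_of_isMutation {k : ℕ} : ∀ {p : ℤ} {Y : ℕ → ℤ → ℝ},
    (∀ i < k, IsMutation (p + i) (Y i) (Y (i + 1))) → ∀ {j : ℤ}, Odd (j + k + p) →
    F (Y 0) j k ≠ 0 := by
  induction k with
  | zero => intro p Y _ j _; rw [F_zero]; exact one_ne_zero
  | succ k ih =>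
    intro p Y h j hj
    have h0 := h 0 (Nat.succ_pos k)
    simp only [Nat.cast_zero, add_zero, zero_add] at h0
    have hj' : Even (j + k + p) := by
      rw [Int.odd_iff] at hj; rw [Int.even_iff]; push_cast at hj; omega
    rw [h0.F_succ hj']
    refine mul_ne_zero (h0.mutationFactor_ne_zero hj') ?_
    refine ih (p := p + 1) (Y := fun i => Y (i + 1)) (fun i hi => ?_) ?_
    · have := h (i + 1) (by omega)
      rwa [show p + ((i + 1 : ℕ) : ℤ) = p + 1 + i by push_cast; ring] at this
    · rw [Int.even_iff] at hj'; rw [Int.odd_iff]; omega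

theorem eq_of_isMutation {k : ℕ} : ∀ {p : ℤ} {Y : ℕ → ℤ → ℝ},
    (∀ i < k, IsMutation (p + i) (Y i) (Y (i + 1))) → ∀ {j : ℤ}, Even (j + k + p) →
    Y k j = (∏ i ∈ Finset.Icc (-(k : ℤ)) k, Y 0 (j + 3 * i)) *
      (F (Y 0) (j - 1) k * F (Y 0) (j + 1) k / (F (Y 0) (j - 3) k * F (Y 0) (j + 3) k)) := by
  induction k with
  | zero => intro p Y _ j _; simp [F_zero]
  | succ k ih =>
    intro p Y h j hj
    have h0 := h 0 (Nat.succ_pos k)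
    simp only [Nat.cast_zero, add_zero, zero_add] at h0
    have hj2 : (j + k + p) % 2 = 1 := by
      rw [Int.even_iff] at hj; push_cast at hj; omega
    have hj1 : ∀ d : ℤ, d % 2 = 1 → Even (j + d + k + p) := fun d hd => by
      rw [Int.even_iff]; omega
    have hm : ∀ i < k, IsMutation (p + 1 + i) (Y (i + 1)) (Y (i + 1 + 1)) := fun i hi => by
      have := h (i + 1) (by omega)
      rwa [show p + ((i + 1 : ℕ) : ℤ) = p + 1 + i by push_cast; ring] at this
    rw [ih (p := p + 1) (Y := fun i => Y (i + 1)) hm (j := j) (by rw [Int.even_iff]; omega)]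
    simp only [zero_add]
    rw [h0.prod_Icc (by push_cast at hj; exact hj)]
    simp only [sub_eq_add_neg]
    have hF : ∀ d : ℤ, d % 2 = 1 → F (Y 0) (j + d) (k + 1) =
        mutationFactor (Y 0) (j + d) k * F (Y 1) (j + d) k := fun d hd => h0.F_succ (hj1 d hd)
    rw [hF 1 (by norm_num), hF (-1) (by norm_num), hF 3 (by norm_num), hF (-3) (by norm_num)]
    rw [mul_assoc, div_mul_div_comm]
    ring

/-- The last mutation inverts the parameter given by `eq_of_isMutation`. -/
theorem eq_inv_of_isMutation {k : ℕ} {p : ℤ} {Y : ℕ → ℤ → ℝ}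
    (h : ∀ i < k + 1, IsMutation (p + i) (Y i) (Y (i + 1))) {j : ℤ} (hj : Even (j + k + p)) :
    Y (k + 1) j = (∏ i ∈ Finset.Icc (-(k : ℤ)) k, Y 0 (j + 3 * i))⁻¹ *
      (F (Y 0) (j - 3) k * F (Y 0) (j + 3) k / (F (Y 0) (j - 1) k * F (Y 0) (j + 1) k)) := by
  rw [(h k (Nat.lt_succ_self k)).even j (by rwa [← add_assoc, add_right_comm]),
    eq_of_isMutation (fun i hi => h i (by omega)) hj, mul_inv, inv_div]

/-! ### Brackets of homogeneous coordinates -/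

section Brackets

variable {R : Type*} [CommRing R]

/-- The determinant of three vectors. -/
def triple (u v w : Fin 3 → R) : R := u ⬝ᵥ crossProduct v w

theorem triple_eq (u v w : Fin 3 → R) : triple u v w =
    u 0 * (v 1 * w 2 - v 2 * w 1) + u 1 * (v 2 * w 0 - v 0 * w 2) +
      u 2 * (v 0 * w 1 - v 1 * w 0) := by
  simp [triple, cross_apply, dotProduct, Fin.sum_univ_three]

theorem cross_cross_cross (u v w x : Fin 3 → R) :
    crossProduct (crossProduct u v) (crossProduct w x) =
      triple u v x • w - triple u v w • x := by
  ext i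
  fin_cases i <;> simp [cross_apply, triple_eq] <;> ring

theorem triple_cross_path (u v w x : Fin 3 → R) :
    triple (crossProduct u v) (crossProduct v w) (crossProduct w x) =
      triple u v w * triple v w x := by
  simp only [triple_eq, cross_apply, Matrix.cons_val]
  ring

theorem triple_cross_path_left (u v w x z : Fin 3 → R) :
    triple (crossProduct u v) (crossProduct v w) (crossProduct x z) =
      triple u v w * triple v x z := by
  simp only [triple_eq, cross_apply, Matrix.cons_val]
  ring

theorem triple_cross_path_right (u v w x z : Fin 3 → R) :
    triple (crossProduct u v) (crossProduct w x) (crossProduct x z) =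
      triple u v x * triple w x z := by
  simp only [triple_eq, cross_apply, Matrix.cons_val]
  ring

theorem triple_cross_interlaced (u v w x z : Fin 3 → R) :
    triple (crossProduct u w) (crossProduct v x) (crossProduct w z) =
      triple u w z * triple v w x := by
  simp only [triple_eq, cross_apply, Matrix.cons_val]
  ring

/-- A three-term Plücker relation between the lines joining `p` to four other points. -/
theorem triple_plucker (p u v w x : Fin 3 → R) :
    triple u v p * triple p w x - triple u p w * triple v p x = -(triple u p x * triple v p w) := by
  simp only [triple_eq]
  ring

/-- The pentagram map on homogeneous coordinates.  The vector `U d` represents the point with index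
`d / 2`, so only the values at `d` of one parity matter. -/
def liftMap (U : ℤ → Fin 3 → R) (d : ℤ) : Fin 3 → R :=
  crossProduct (crossProduct (U (d - 3)) (U (d + 1))) (crossProduct (U (d - 1)) (U (d + 3)))

/-- The bracket of the points `i`, `i + 1`, `i + 2`, for `i = d / 2`. -/
def brA (U : ℤ → Fin 3 → R) (d : ℤ) : R := triple (U d) (U (d + 2)) (U (d + 4))

/-- The bracket of the points `i`, `i + 1`, `i + 3`, for `i = d / 2`. -/
def brB (U : ℤ → Fin 3 → R) (d : ℤ) : R := triple (U d) (U (d + 2)) (U (d + 6))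

/-- The bracket of the points `i`, `i + 2`, `i + 3`, for `i = d / 2`. -/
def brC (U : ℤ → Fin 3 → R) (d : ℤ) : R := triple (U d) (U (d + 4)) (U (d + 6))

/-- The bracket of the points `i`, `i + 2`, `i + 4`, for `i = d / 2`. -/
def brE (U : ℤ → Fin 3 → R) (d : ℤ) : R := triple (U d) (U (d + 4)) (U (d + 8))

variable (U : ℤ → Fin 3 → R) (d : ℤ)

theorem brA_liftMap :
    brA (liftMap U) d = brE U (d - 3) * brA U (d - 1) * (brE U (d - 1) * brA U (d + 1)) := by
  simp only [brA, brE, liftMap]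
  ring_nf
  rw [triple_cross_path, triple_cross_interlaced, triple_cross_interlaced]
  ring

theorem brB_liftMap :
    brB (liftMap U) d = brE U (d - 3) * brA U (d - 1) * (brE U (d - 1) * brB U (d + 3)) := by
  simp only [brA, brB, brE, liftMap]
  ring_nf
  rw [triple_cross_path_left, triple_cross_interlaced, triple_cross_path_left]
  ring

theorem brC_liftMap :
    brC (liftMap U) d = brE U (d - 1) * brC U (d - 3) * (brE U (d + 1) * brA U (d + 3)) := by
  simp only [brA, brC, brE, liftMap]
  ring_nf
  rw [triple_cross_path_right, triple_cross_interlaced, triple_cross_path_right]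
  ring

theorem brA_mul_sub :
    brA U (d - 4) * brA U d - brC U (d - 4) * brB U (d - 2) =
      -(brE U (d - 4) * brA U (d - 2)) := by
  have h := triple_plucker (U d) (U (d - 4)) (U (d - 2)) (U (d + 2)) (U (d + 4))
  simp only [brA, brB, brC, brE]
  ring_nf at h ⊢
  exact h

end Brackets

/-- The `y`-parameter at a vertex in terms of brackets. -/
def vertexY (U : ℤ → Fin 3 → ℝ) (d : ℤ) : ℝ :=
  -(brC U (d - 4) * brB U (d - 2) / (brA U (d - 4) * brA U d))

/-- The `y`-parameter on an edge in terms of brackets. -/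
def edgeY (U : ℤ → Fin 3 → ℝ) (d : ℤ) : ℝ :=
  -(brA U (d - 4) * brA U (d + 2) / (brB U (d - 4) * brC U d))

/-- The `y`-parameters in terms of brackets; `p` is the parity of the indices of the vertices. -/
def liftY (p : ℤ) (U : ℤ → Fin 3 → ℝ) (j : ℤ) : ℝ :=
  if Even (j + p) then vertexY U j else edgeY U (j - 1)

/-- The polygon is generic enough for all its `y`-parameters to be defined. -/
structure IsGeneric (p : ℤ) (U : ℤ → Fin 3 → ℝ) : Prop where
  brA_ne_zero : ∀ d, Even (d + p) → brA U d ≠ 0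
  brB_ne_zero : ∀ d, Even (d + p) → brB U d ≠ 0
  brC_ne_zero : ∀ d, Even (d + p) → brC U d ≠ 0

theorem one_add_vertexY {U : ℤ → Fin 3 → ℝ} {d : ℤ} (h1 : brA U (d - 4) ≠ 0) (h2 : brA U d ≠ 0) :
    1 + vertexY U d = -(brE U (d - 4) * brA U (d - 2) / (brA U (d - 4) * brA U d)) := by
  have h := brA_mul_sub U d
  unfold vertexY
  field_simp
  linear_combination h

theorem IsGeneric.liftY_ne_zero {p : ℤ} {U : ℤ → Fin 3 → ℝ} (h : IsGeneric p U) (j : ℤ) :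
    liftY p U j ≠ 0 := by
  unfold liftY
  split_ifs with hj
  · rw [Int.even_iff] at hj
    exact neg_ne_zero.2 (div_ne_zero
      (mul_ne_zero (h.brC_ne_zero _ (by rw [Int.even_iff]; omega))
        (h.brB_ne_zero _ (by rw [Int.even_iff]; omega)))
      (mul_ne_zero (h.brA_ne_zero _ (by rw [Int.even_iff]; omega))
        (h.brA_ne_zero _ (by rw [Int.even_iff]; omega))))
  · rw [Int.even_iff] at hj
    exact neg_ne_zero.2 (div_ne_zero
      (mul_ne_zero (h.brA_ne_zero _ (by rw [Int.even_iff]; omega))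
        (h.brA_ne_zero _ (by rw [Int.even_iff]; omega)))
      (mul_ne_zero (h.brB_ne_zero _ (by rw [Int.even_iff]; omega))
        (h.brC_ne_zero _ (by rw [Int.even_iff]; omega))))

/-- The pentagram map acts on the `y`-parameters by mutation. -/
theorem IsGeneric.isMutation {p : ℤ} {U : ℤ → Fin 3 → ℝ} (h : IsGeneric p U)
    (h' : IsGeneric (p + 1) (liftMap U)) :
    IsMutation p (liftY p U) (liftY (p + 1) (liftMap U)) := by
  have hE : ∀ d, Even (d + p) → brE U d ≠ 0 := fun d hd => by
    have := h'.brA_ne_zero (d + 3) (by rw [Int.even_iff] at *; omega)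
    rw [brA_liftMap, add_sub_cancel_right] at this
    exact left_ne_zero_of_mul (left_ne_zero_of_mul this)
  have hone : ∀ i, Even (i + p) → 1 + liftY p U i =
      -(brE U (i - 4) * brA U (i - 2) / (brA U (i - 4) * brA U i)) := fun i hi => by
    rw [liftY, if_pos hi]
    rw [Int.even_iff] at hi
    exact one_add_vertexY (h.brA_ne_zero _ (by rw [Int.even_iff]; omega))
      (h.brA_ne_zero _ (by rw [Int.even_iff]; omega))
  refine ⟨h.liftY_ne_zero, fun i hi => ?_, fun i hi => ?_, fun i hi => ?_⟩
  · rw [hone i hi]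
    rw [Int.even_iff] at hi
    exact neg_ne_zero.2 (div_ne_zero
      (mul_ne_zero (hE _ (by rw [Int.even_iff]; omega))
        (h.brA_ne_zero _ (by rw [Int.even_iff]; omega)))
      (mul_ne_zero (h.brA_ne_zero _ (by rw [Int.even_iff]; omega))
        (h.brA_ne_zero _ (by rw [Int.even_iff]; omega))))
  · rw [liftY, liftY, if_pos hi]
    rw [Int.even_iff] at hi
    rw [if_neg (by rw [Int.even_iff]; omega)]
    have n1 := hE (i - 8) (by rw [Int.even_iff]; omega)
    have n2 := hE (i - 6) (by rw [Int.even_iff]; omega)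
    have n3 := hE (i - 2) (by rw [Int.even_iff]; omega)
    have n4 := hE i (by rw [Int.even_iff]; omega)
    have n5 := h.brA_ne_zero (i - 6) (by rw [Int.even_iff]; omega)
    have n6 := h.brA_ne_zero (i + 2) (by rw [Int.even_iff]; omega)
    have n7 := h.brA_ne_zero (i - 4) (by rw [Int.even_iff]; omega)
    have n8 := h.brA_ne_zero i (by rw [Int.even_iff]; omega)
    have n9 := h.brB_ne_zero (i - 2) (by rw [Int.even_iff]; omega)
    have n10 := h.brC_ne_zero (i - 4) (by rw [Int.even_iff]; omega)
    unfold edgeY vertexY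
    rw [brA_liftMap, brA_liftMap, brB_liftMap, brC_liftMap]
    ring_nf at *
    field_simp
  · rw [hone _ (by rw [Int.odd_iff] at hi; rw [Int.even_iff]; omega),
      hone _ (by rw [Int.odd_iff] at hi; rw [Int.even_iff]; omega),
      hone _ (by rw [Int.odd_iff] at hi; rw [Int.even_iff]; omega),
      hone _ (by rw [Int.odd_iff] at hi; rw [Int.even_iff]; omega)]
    rw [Int.odd_iff] at hi
    have hv : ∀ m, (m + p) % 2 = 0 → liftY p U m = vertexY U m := fun m hm =>
      if_pos (by rw [Int.even_iff]; omega)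
    have hv' : liftY (p + 1) (liftMap U) i = vertexY (liftMap U) i :=
      if_pos (by rw [Int.even_iff]; omega)
    have he : liftY p U i = edgeY U (i - 1) := if_neg (by rw [Int.even_iff]; omega)
    rw [hv (i - 3) (by omega), hv (i + 3) (by omega), hv', he]
    have e1 := hE (i - 7) (by rw [Int.even_iff]; omega)
    have e2 := hE (i - 5) (by rw [Int.even_iff]; omega)
    have e3 := hE (i - 3) (by rw [Int.even_iff]; omega)
    have e4 := hE (i - 1) (by rw [Int.even_iff]; omega)
    have a1 := h.brA_ne_zero (i - 7) (by rw [Int.even_iff]; omega)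
    have a2 := h.brA_ne_zero (i - 5) (by rw [Int.even_iff]; omega)
    have a3 := h.brA_ne_zero (i - 3) (by rw [Int.even_iff]; omega)
    have a4 := h.brA_ne_zero (i - 1) (by rw [Int.even_iff]; omega)
    have a5 := h.brA_ne_zero (i + 1) (by rw [Int.even_iff]; omega)
    have a6 := h.brA_ne_zero (i + 3) (by rw [Int.even_iff]; omega)
    have b1 := h.brB_ne_zero (i - 5) (by rw [Int.even_iff]; omega)
    have c1 := h.brC_ne_zero (i - 1) (by rw [Int.even_iff]; omega)
    unfold vertexY edgeY
    rw [brA_liftMap, brA_liftMap, brB_liftMap, brC_liftMap]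
    simp only [sub_sub, sub_add_eq_add_sub, add_sub_assoc] at *
    norm_num at *
    simp only [← sub_eq_add_neg] at *
    field_simp

/-! ### Homogeneous coordinates of polygons -/

/-- The vectors `U d`, for `d` of the parity of `p`, are homogeneous coordinates of the points of
`A`. -/
structure Represents (p : ℤ) (U : ℤ → Fin 3 → ℝ) (A : Polygon) : Prop where
  isIndex_iff : ∀ d, A.IsIndex d ↔ Even (d + p)
  exists_at₂_eq : ∀ d, Even (d + p) → ∃ h : U d ≠ 0, A.at₂ d = .mk ℝ (U d) h

theorem cross_mk_eq {u v : Fin 3 → ℝ} {hu : u ≠ 0} {hv : v ≠ 0}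
    (h : Projectivization.mk ℝ u hu ≠ .mk ℝ v hv) :
    ∃ h' : crossProduct u v ≠ 0,
      Projectivization.cross (.mk ℝ u hu) (.mk ℝ v hv) = .mk ℝ _ h' :=
  ⟨mt (Projectivization.mk_eq_mk_iff_crossProduct_eq_zero hu hv).2 h,
    Projectivization.cross_mk_of_ne hu hv h⟩

theorem mk_ne_mk_iff {u v : Fin 3 → ℝ} (hu : u ≠ 0) (hv : v ≠ 0) :
    Projectivization.mk ℝ u hu ≠ .mk ℝ v hv ↔ crossProduct u v ≠ 0 :=
  (Projectivization.mk_eq_mk_iff_crossProduct_eq_zero hu hv).not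

theorem cross_cross_pencil (p u v : Fin 3 → ℝ) :
    crossProduct (crossProduct p u) (crossProduct p v) = triple p u v • p := by
  rw [cross_cross_cross]
  have : triple p u p = 0 := by rw [triple_eq]; ring
  rw [this, zero_smul, sub_zero]

/-- The cross ratio of four lines through a point. -/
theorem crossRatio_pencil {p a b c d : Fin 3 → ℝ} (hp : p ≠ 0) (ha : crossProduct p a ≠ 0)
    (hb : crossProduct p b ≠ 0) (hc : crossProduct p c ≠ 0) (hd : crossProduct p d ≠ 0) :
    crossRatio (.mk ℝ _ ha) (.mk ℝ _ hb) (.mk ℝ _ hc) (.mk ℝ _ hd) =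
      (triple p a b * triple p c d) / (triple p a c * triple p b d) := by
  have h : p ⬝ᵥ p ≠ 0 := by rwa [Ne, dotProduct_self_eq_zero]
  rw [crossRatio_mk]
  simp only [cross_cross_pencil, dotProduct_smul, smul_dotProduct, smul_eq_mul]
  rw [← mul_div_mul_right (triple p a b * triple p c d) _ h]
  congr 1 <;> ring

namespace Represents

variable {p : ℤ} {U : ℤ → Fin 3 → ℝ} {A : Polygon}

theorem exists_side_eq (h : Represents p U A) {d e : ℤ} (hd : Even (d + p)) (he : Even (e + p))
    (hne : A.at₂ d ≠ A.at₂ e) :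
    ∃ h' : crossProduct (U d) (U e) ≠ 0, A.side d e = .mk ℝ _ h' := by
  obtain ⟨h1, e1⟩ := h.exists_at₂_eq d hd
  obtain ⟨h2, e2⟩ := h.exists_at₂_eq e he
  unfold Polygon.side lineThrough
  rw [e1, e2] at hne ⊢
  exact cross_mk_eq hne

theorem pentagramMap (h : Represents p U A) (hA : A.PentagramDefined) :
    Represents (p + 1) (liftMap U) A.pentagramMap := by
  have hidx : ∀ d, A.pentagramMap.IsIndex d ↔ Even (d + (p + 1)) := fun d => by
    have h1 := h.isIndex_iff (d + 1)
    have h2 := h.isIndex_iff d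
    unfold Polygon.IsIndex Polygon.pentagramMap at *
    rw [Int.even_iff] at *
    cases hh : A.half <;> simp only [hh, Int.odd_iff, Int.even_iff, if_true, if_false,
      Bool.not_true, Bool.not_false, Bool.false_eq_true] at * <;> omega
  refine ⟨hidx, fun d hd => ?_⟩
  have hd' := (hidx d).2 hd
  have hat : A.pentagramMap.at₂ d =
      meet (A.side (d - 3) (d + 1)) (A.side (d - 1) (d + 3)) := by
    unfold Polygon.at₂ Polygon.pentagramMap
    unfold Polygon.IsIndex Polygon.pentagramMap at hd'
    cases hh : A.half
    · simp only [hh, Bool.not_false, if_true, Int.odd_iff] at hd'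
      simp only [Bool.false_eq_true, if_false]
      rw [show 2 * (d / 2) + 1 = d by omega]
    · simp only [hh, Bool.not_true, Bool.false_eq_true, if_false, Int.even_iff] at hd'
      simp only [if_true]
      rw [show 2 * (d / 2) = d by omega]
  have hpar : ∀ m : ℤ, m % 2 = 1 → Even (d + m + p) := fun m hm => by
    rw [Int.even_iff] at *; omega
  have hdef := hA (d + -1) ((h.isIndex_iff _).2 (hpar (-1) (by norm_num)))
  rw [show d + -1 - 2 = d + -3 by ring, show d + -1 + 2 = d + 1 by ring,
    show d + -1 + 4 = d + 3 by ring] at hdef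
  obtain ⟨n1, n2, n3⟩ := hdef
  obtain ⟨s1, e1⟩ := h.exists_side_eq (hpar (-3) (by norm_num)) (hpar 1 (by norm_num)) n1
  obtain ⟨s2, e2⟩ := h.exists_side_eq (hpar (-1) (by norm_num)) (hpar 3 (by norm_num)) n2
  rw [e1, e2] at n3
  rw [hat]
  simp only [sub_eq_add_neg, liftMap, meet]
  rw [e1, e2]
  exact cross_mk_eq n3

theorem of_vertexDefined (h : Represents p U A) {d : ℤ} (hd : Even (d + p))
    (hA : A.VertexDefined d) :
    brA U (d - 4) ≠ 0 ∧ brA U d ≠ 0 ∧ brC U (d - 4) ≠ 0 ∧ brB U (d - 2) ≠ 0 ∧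
      -(A.vertexCrossRatio d)⁻¹ = vertexY U d := by
  obtain ⟨n1, n2, n3, n4, ⟨n5, n6⟩, n7⟩ := hA
  have hpar : ∀ m : ℤ, m % 2 = 0 → Even (d + m + p) := fun m hm => by
    rw [Int.even_iff] at *; omega
  obtain ⟨h0, -⟩ := h.exists_at₂_eq d hd
  obtain ⟨s1, e1⟩ := h.exists_side_eq hd (hpar (-4) (by norm_num)) n1
  obtain ⟨s2, e2⟩ := h.exists_side_eq hd (hpar (-2) (by norm_num)) n2
  obtain ⟨s3, e3⟩ := h.exists_side_eq hd (hpar 2 (by norm_num)) n3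
  obtain ⟨s4, e4⟩ := h.exists_side_eq hd (hpar 4 (by norm_num)) n4
  simp only [sub_eq_add_neg] at n5 n6
  rw [e1, e3, mk_ne_mk_iff, cross_cross_pencil] at n5
  rw [e2, e4, mk_ne_mk_iff, cross_cross_pencil] at n6
  have hr : A.vertexCrossRatio d = crossRatio (A.side d (d + -4)) (A.side d (d + -2))
      (A.side d (d + 2)) (A.side d (d + 4)) := rfl
  rw [e1, e2, e3, e4, crossRatio_pencil h0 s1 s2 s3 s4] at hr
  have t1 : triple (U d) (U (d + -4)) (U (d + -2)) = brA U (d - 4) := by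
    simp only [brA, triple_eq]; ring_nf
  have t2 : triple (U d) (U (d + 2)) (U (d + 4)) = brA U d := rfl
  have t3 : triple (U d) (U (d + -4)) (U (d + 2)) = -brC U (d - 4) := by
    simp only [brC, triple_eq]; ring_nf
  have t4 : triple (U d) (U (d + -2)) (U (d + 4)) = -brB U (d - 2) := by
    simp only [brB, triple_eq]; ring_nf
  rw [t1, t2, t3, t4, neg_mul_neg] at hr
  rw [t3] at n5
  rw [t4] at n6
  rw [hr] at n7 ⊢
  refine ⟨?_, ?_, ?_, ?_, ?_⟩
  · exact left_ne_zero_of_mul (fun h0 => n7 (by rw [h0, zero_div]))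
  · exact right_ne_zero_of_mul (fun h0 => n7 (by rw [h0, zero_div]))
  · exact fun h0 => n5 (by simp [h0])
  · exact fun h0 => n6 (by simp [h0])
  · rw [inv_div, vertexY]

theorem of_edgeDefined (h : Represents p U A) {d : ℤ} (hd : Even (d + p))
    (hA : A.EdgeDefined d) :
    brB U (d - 4) ≠ 0 ∧ brC U d ≠ 0 ∧ -A.edgeCrossRatio d = edgeY U d := by
  obtain ⟨n1, n2, n3, n4, n5, n6, n7⟩ := hA
  have hpar : ∀ m : ℤ, m % 2 = 0 → Even (d + m + p) := fun m hm => by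
    rw [Int.even_iff] at *; omega
  simp only [sub_eq_add_neg] at n1 n4 n6 n7
  obtain ⟨h0, v0⟩ := h.exists_at₂_eq d hd
  obtain ⟨h1, v1⟩ := h.exists_at₂_eq (d + 2) (hpar 2 (by norm_num))
  obtain ⟨s1, e1⟩ := h.exists_side_eq (hpar (-4) (by norm_num)) (hpar (-2) (by norm_num)) n1
  obtain ⟨s2, e2⟩ := h.exists_side_eq hd (hpar 2 (by norm_num)) n2
  obtain ⟨s3, e3⟩ := h.exists_side_eq (hpar 4 (by norm_num)) (hpar 6 (by norm_num)) n3
  have hr : A.edgeCrossRatio d = crossRatio (meet (A.side (d + -4) (d + -2)) (A.side d (d + 2)))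
      (A.at₂ d) (A.at₂ (d + 2)) (meet (A.side (d + 4) (d + 6)) (A.side d (d + 2))) := rfl
  unfold meet at n6 n7 hr
  rw [e1, e2] at n4
  rw [e3, e2] at n5
  obtain ⟨m1, f1⟩ := cross_mk_eq n4
  obtain ⟨m2, f2⟩ := cross_mk_eq n5
  rw [e1, e2, f1, v1, mk_ne_mk_iff] at n6
  rw [e2, e3, f2, v0, mk_ne_mk_iff] at n7
  rw [e1, e2, e3, f1, f2, v0, v1, crossRatio_mk] at hr
  have hL : crossProduct (U d) (U (d + 2)) ⬝ᵥ crossProduct (U d) (U (d + 2)) ≠ 0 := by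
    rwa [Ne, dotProduct_self_eq_zero]
  have c1 : ∀ u v w x : Fin 3 → ℝ,
      crossProduct (crossProduct (crossProduct u v) (crossProduct w x)) w =
        triple u v w • crossProduct w x := fun u v w x => by
    ext i; fin_cases i <;> simp [cross_apply, triple_eq] <;> ring
  have c2 : ∀ u v w x : Fin 3 → ℝ,
      crossProduct (crossProduct (crossProduct u v) (crossProduct w x)) x =
        triple u v x • crossProduct w x := fun u v w x => by
    ext i; fin_cases i <;> simp [cross_apply, triple_eq] <;> ring
  have c3 : ∀ u v w x : Fin 3 → ℝ,
      crossProduct w (crossProduct (crossProduct u v) (crossProduct w x)) =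
        -(triple u v w) • crossProduct w x := fun u v w x => by
    ext i; fin_cases i <;> simp [cross_apply, triple_eq] <;> ring
  have c4 : ∀ u v w x : Fin 3 → ℝ,
      crossProduct x (crossProduct (crossProduct u v) (crossProduct w x)) =
        -(triple u v x) • crossProduct w x := fun u v w x => by
    ext i; fin_cases i <;> simp [cross_apply, triple_eq] <;> ring
  have t1 : triple (U (d + -4)) (U (d + -2)) (U d) = brA U (d - 4) := by
    simp only [brA, triple_eq]; ring_nf
  have t2 : triple (U (d + -4)) (U (d + -2)) (U (d + 2)) = brB U (d - 4) := by
    simp only [brB, triple_eq]; ring_nf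
  have t3 : triple (U (d + 4)) (U (d + 6)) (U d) = brC U d := by
    simp only [brC, triple_eq]; ring_nf
  have t4 : triple (U (d + 4)) (U (d + 6)) (U (d + 2)) = brA U (d + 2) := by
    simp only [brA, triple_eq]; ring_nf
  rw [c2, t2] at n6
  rw [← cross_anticomm, c1, t3] at n7
  rw [c1, c2, c3, c4, t1, t2, t3, t4] at hr
  simp only [dotProduct_smul, smul_dotProduct, smul_eq_mul] at hr
  have b0 : brB U (d - 4) ≠ 0 := fun h0 => n6 (by simp [h0])
  have c0 : brC U d ≠ 0 := fun h0 => n7 (by simp [h0])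
  refine ⟨b0, c0, ?_⟩
  rw [hr, edgeY]
  field_simp

theorem y_eq (h : Represents p U A) {j : ℤ} (hj : A.YDefined j) : A.y j = liftY p U j := by
  unfold Polygon.y liftY
  by_cases hp : Even (j + p)
  · rw [if_pos ((h.isIndex_iff j).2 hp), if_pos hp]
    exact (h.of_vertexDefined hp (hj.1 ((h.isIndex_iff j).2 hp))).2.2.2.2
  · have hi : ¬ A.IsIndex j := fun hi => hp ((h.isIndex_iff j).1 hi)
    rw [if_neg hi, if_neg hp]
    have hp' : Even (j - 1 + p) := by rw [Int.even_iff] at *; omega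
    exact (h.of_edgeDefined hp' (hj.2 hi)).2.2

theorem isGeneric (h : Represents p U A) (hy : ∀ j, A.YDefined j) : IsGeneric p U := by
  have hv : ∀ d, Even (d + p) → A.VertexDefined d := fun d hd =>
    (hy d).1 ((h.isIndex_iff d).2 hd)
  refine ⟨fun d hd => (h.of_vertexDefined hd (hv d hd)).2.1, fun d hd => ?_, fun d hd => ?_⟩
  · have hd' : Even (d + 2 + p) := by rw [Int.even_iff] at *; omega
    have := (h.of_vertexDefined hd' (hv _ hd')).2.2.2.1
    rwa [add_sub_cancel_right] at this
  · have hd' : Even (d + 4 + p) := by rw [Int.even_iff] at *; omega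
    have := (h.of_vertexDefined hd' (hv _ hd')).2.2.1
    rwa [add_sub_cancel_right] at this

theorem iterate (h : Represents p U A) {k : ℕ} (hA : A.IterDefined k) :
    Represents (p + k) (liftMap^[k] U) (Polygon.pentagramMap^[k] A) := by
  induction k with
  | zero => simpa using h
  | succ k ih =>
    rw [Function.iterate_succ_apply', Function.iterate_succ_apply', Nat.cast_succ, ← add_assoc]
    exact (ih fun i hi => hA i (by omega)).pentagramMap (hA k (Nat.lt_succ_self k))

end Represents

theorem represents_rep (A : Polygon) (hA : A.half = false) :
    Represents 0 (fun d => (A.at₂ d).rep) A where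
  isIndex_iff d := by simp [Polygon.IsIndex, hA]
  exists_at₂_eq d _ := ⟨Projectivization.rep_nonzero _, (Projectivization.mk_rep _).symm⟩

/-! ### Deformation to a generic polygon -/

section Deformation

open Polynomial Filter Topology

theorem map_liftMap {R S : Type*} [CommRing R] [CommRing S] (f : R →+* S) (U : ℤ → Fin 3 → R) :
    (fun d i => f (liftMap U d i)) = liftMap fun d i => f (U d i) := by
  ext d i
  fin_cases i <;> simp [liftMap, cross_apply]

theorem map_iterate_liftMap {R S : Type*} [CommRing R] [CommRing S] (f : R →+* S)
    (U : ℤ → Fin 3 → R) (m : ℕ) :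
    (fun d i => f (liftMap^[m] U d i)) = liftMap^[m] fun d i => f (U d i) := by
  induction m with
  | zero => rfl
  | succ m ih =>
    rw [Function.iterate_succ_apply', Function.iterate_succ_apply', ← ih, map_liftMap]

theorem map_triple {R S : Type*} [CommRing R] [CommRing S] (f : R →+* S) (u v w : Fin 3 → R) :
    f (triple u v w) = triple (fun i => f (u i)) (fun i => f (v i)) (fun i => f (w i)) := by
  simp [triple_eq]

/-- Homogeneous coordinates of points with equidistant abscissas on the parabola
`Y = X ^ 2 + τ`. -/
def parabola (c τ : ℝ) (d : ℤ) : Fin 3 → ℝ := ![c, c * d, c * ((d : ℝ) ^ 2 + τ)]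

theorem liftMap_parabola (c τ : ℝ) :
    liftMap (parabola c τ) = parabola (64 * c ^ 4) (τ + 3) := by
  ext d i
  fin_cases i <;> simp [liftMap, parabola, cross_apply] <;> ring

theorem exists_iterate_liftMap_parabola (m : ℕ) :
    ∃ c τ : ℝ, c ≠ 0 ∧ liftMap^[m] (parabola 1 0) = parabola c τ := by
  induction m with
  | zero => exact ⟨1, 0, one_ne_zero, rfl⟩
  | succ m ih =>
    obtain ⟨c, τ, hc, h⟩ := ih
    exact ⟨64 * c ^ 4, τ + 3, by positivity,
      by rw [Function.iterate_succ_apply', h, liftMap_parabola]⟩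

theorem brA_parabola (c τ : ℝ) (d : ℤ) : brA (parabola c τ) d = 16 * c ^ 3 := by
  simp [brA, triple_eq, parabola]; ring

theorem brB_parabola (c τ : ℝ) (d : ℤ) : brB (parabola c τ) d = 48 * c ^ 3 := by
  simp [brB, triple_eq, parabola]; ring

theorem brC_parabola (c τ : ℝ) (d : ℤ) : brC (parabola c τ) d = 48 * c ^ 3 := by
  simp [brC, triple_eq, parabola]; ring

/-- The line in the space of coordinates from `U` to the coordinates of a parabolic polygon, as a
sequence of vectors of polynomials. -/
def deformation (U : ℤ → Fin 3 → ℝ) (d : ℤ) (i : Fin 3) : ℝ[X] :=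
  C (U d i) + X * C (parabola 1 0 d i - U d i)

/-- The value of `deformation U` at a parameter. -/
def deform (U : ℤ → Fin 3 → ℝ) (x : ℝ) (d : ℤ) (i : Fin 3) : ℝ := (deformation U d i).eval x

variable (U : ℤ → Fin 3 → ℝ)

theorem deform_zero : deform U 0 = U := by
  ext d i
  simp [deform, deformation]

theorem deform_one : deform U 1 = parabola 1 0 := by
  ext d i
  simp [deform, deformation]

theorem iterate_deform (m : ℕ) (x : ℝ) :
    liftMap^[m] (deform U x) = fun d i => (liftMap^[m] (deformation U) d i).eval x :=
  (map_iterate_liftMap (evalRingHom x) (deformation U) m).symm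

theorem brA_deform (m : ℕ) (d : ℤ) (x : ℝ) :
    brA (liftMap^[m] (deform U x)) d = (brA (liftMap^[m] (deformation U)) d).eval x := by
  rw [iterate_deform]
  exact (map_triple (evalRingHom x) _ _ _).symm

theorem brB_deform (m : ℕ) (d : ℤ) (x : ℝ) :
    brB (liftMap^[m] (deform U x)) d = (brB (liftMap^[m] (deformation U)) d).eval x := by
  rw [iterate_deform]
  exact (map_triple (evalRingHom x) _ _ _).symm

theorem brC_deform (m : ℕ) (d : ℤ) (x : ℝ) :
    brC (liftMap^[m] (deform U x)) d = (brC (liftMap^[m] (deformation U)) d).eval x := by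
  rw [iterate_deform]
  exact (map_triple (evalRingHom x) _ _ _).symm

/-- All iterates of the deformed polygon are generic for parameters arbitrarily close to `0`, since
the brackets are polynomials in the parameter that do not vanish at `1`. -/
theorem frequently_isGeneric :
    ∃ᶠ x in 𝓝 (0 : ℝ), ∀ (p : ℤ) (m : ℕ), IsGeneric p (liftMap^[m] (deform U x)) := by
  set q : ℕ × ℤ → ℝ[X] := fun a => brA (liftMap^[a.1] (deformation U)) a.2 *
    (brB (liftMap^[a.1] (deformation U)) a.2 * brC (liftMap^[a.1] (deformation U)) a.2) with hq
  have hq0 : ∀ a, q a ≠ 0 := by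
    intro a h
    have h1 : (q a).eval 1 = 0 := by rw [h, eval_zero]
    obtain ⟨c, τ, hc, hp⟩ := exists_iterate_liftMap_parabola a.1
    rw [hq] at h1
    simp only [eval_mul, ← brA_deform, ← brB_deform, ← brC_deform, deform_one, hp, brA_parabola,
      brB_parabola, brC_parabola] at h1
    simp [hc] at h1
  have hcount : (⋃ a, {x | (q a).eval x = 0}).Countable := by
    refine Set.countable_iUnion fun a => Set.Finite.countable ?_
    refine ((q a).roots.toFinset.finite_toSet).subset fun x hx => ?_
    simpa [hq0 a] using hx
  have hdense := (hcount.dense_compl ℝ) 0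
  rw [mem_closure_iff_frequently] at hdense
  refine hdense.mono fun x hx p m => ?_
  have hx' : ∀ d, (q (m, d)).eval x ≠ 0 := fun d h => hx (Set.mem_iUnion.2 ⟨(m, d), h⟩)
  simp only [hq, eval_mul, ← brA_deform, ← brB_deform, ← brC_deform, mul_ne_zero_iff] at hx'
  exact ⟨fun d _ => (hx' d).1, fun d _ => (hx' d).2.1, fun d _ => (hx' d).2.2⟩

/-- The denominator of the parameter `liftY p U j` does not vanish. -/
def LiftYDefined (p : ℤ) (U : ℤ → Fin 3 → ℝ) (j : ℤ) : Prop :=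
  (Even (j + p) → brA U (j - 4) * brA U j ≠ 0) ∧
    (¬ Even (j + p) → brB U (j - 1 - 4) * brC U (j - 1) ≠ 0)

variable {U}

theorem IsGeneric.liftYDefined {p : ℤ} (h : IsGeneric p U) (j : ℤ) : LiftYDefined p U j := by
  constructor <;> intro hj <;> rw [Int.even_iff] at hj
  · exact mul_ne_zero (h.brA_ne_zero _ (by rw [Int.even_iff]; omega))
      (h.brA_ne_zero _ (by rw [Int.even_iff]; omega))
  · exact mul_ne_zero (h.brB_ne_zero _ (by rw [Int.even_iff]; omega))
      (h.brC_ne_zero _ (by rw [Int.even_iff]; omega))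

theorem Represents.liftYDefined {p : ℤ} {A : Polygon} (h : Represents p U A) {j : ℤ}
    (hj : A.YDefined j) : LiftYDefined p U j := by
  constructor <;> intro hp
  · have := h.of_vertexDefined hp (hj.1 ((h.isIndex_iff j).2 hp))
    exact mul_ne_zero this.1 this.2.1
  · have hp' : Even (j - 1 + p) := by rw [Int.even_iff] at *; omega
    have := h.of_edgeDefined hp' (hj.2 fun hi => hp ((h.isIndex_iff j).1 hi))
    exact mul_ne_zero this.1 this.2.1

/-- A parameter of an iterate is continuous in the deformation where its denominator is nonzero. -/
theorem tendsto_liftY {p j : ℤ} {m : ℕ} (h : LiftYDefined p (liftMap^[m] U) j) :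
    Tendsto (fun x => liftY p (liftMap^[m] (deform U x)) j) (𝓝 0)
      (𝓝 (liftY p (liftMap^[m] U) j)) := by
  have hA : ∀ d, Tendsto (fun x => brA (liftMap^[m] (deform U x)) d) (𝓝 0)
      (𝓝 (brA (liftMap^[m] U) d)) := fun d => by
    have := (brA (liftMap^[m] (deformation U)) d).continuous.tendsto 0
    simpa only [← brA_deform, deform_zero] using this
  have hB : ∀ d, Tendsto (fun x => brB (liftMap^[m] (deform U x)) d) (𝓝 0)
      (𝓝 (brB (liftMap^[m] U) d)) := fun d => by
    have := (brB (liftMap^[m] (deformation U)) d).continuous.tendsto 0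
    simpa only [← brB_deform, deform_zero] using this
  have hC : ∀ d, Tendsto (fun x => brC (liftMap^[m] (deform U x)) d) (𝓝 0)
      (𝓝 (brC (liftMap^[m] U) d)) := fun d => by
    have := (brC (liftMap^[m] (deformation U)) d).continuous.tendsto 0
    simpa only [← brC_deform, deform_zero] using this
  unfold liftY
  split_ifs with hp
  · exact (((hC _).mul (hB _)).div ((hA _).mul (hA _)) (h.1 hp)).neg
  · exact (((hA _).mul (hA _)).div ((hB _).mul (hC _)) (h.2 hp)).neg

theorem tendsto_F {α : Type*} {l : Filter α} {y : α → ℤ → ℝ} {y₀ : ℤ → ℝ}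
    (h : ∀ i, Tendsto (fun x => y x i) l (𝓝 (y₀ i))) (j : ℤ) (k : ℕ) :
    Tendsto (fun x => F (y x) j k) l (𝓝 (F y₀ j k)) := by
  unfold F
  exact tendsto_finsetSum _ fun I _ => tendsto_finsetProd _ fun x _ => h _

theorem isMutation_of_isGeneric {k : ℕ} {p : ℤ}
    (h : ∀ m ≤ k, IsGeneric (p + m) (liftMap^[m] U)) :
    ∀ i < k, IsMutation (p + i) (liftY (p + i) (liftMap^[i] U))
      (liftY (p + (i + 1 : ℕ)) (liftMap^[i + 1] U)) := by
  intro i hi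
  have h2 := h (i + 1) hi
  rw [Nat.cast_succ, ← add_assoc] at h2 ⊢
  rw [Function.iterate_succ_apply'] at h2 ⊢
  exact (h i hi.le).isMutation h2

theorem liftY_eq_of_even (h0 : IsGeneric 0 U) {k : ℕ} {j : ℤ}
    (hk : LiftYDefined k (liftMap^[k] U) j) (hj : Even (j + k))
    (h1 : F (liftY 0 U) (j - 3) k ≠ 0) (h2 : F (liftY 0 U) (j + 3) k ≠ 0) :
    liftY k (liftMap^[k] U) j =
      (∏ i ∈ Finset.Icc (-(k : ℤ)) k, liftY 0 U (j + 3 * i)) *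
        (F (liftY 0 U) (j - 1) k * F (liftY 0 U) (j + 1) k /
          (F (liftY 0 U) (j - 3) k * F (liftY 0 U) (j + 3) k)) := by
  have hy : ∀ i, Tendsto (fun x => liftY 0 (deform U x) i) (𝓝 0) (𝓝 (liftY 0 U i)) := fun i =>
    tendsto_liftY (m := 0) (h0.liftYDefined i)
  refine tendsto_nhds_unique_of_frequently_eq (tendsto_liftY hk)
    ((tendsto_finsetProd _ fun i _ => hy (j + 3 * i)).mul
      (((tendsto_F hy (j - 1) k).mul (tendsto_F hy (j + 1) k)).div
        ((tendsto_F hy (j - 3) k).mul (tendsto_F hy (j + 3) k)) (mul_ne_zero h1 h2))) ?_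
  refine (frequently_isGeneric U).mono fun x hx => ?_
  have hm := isMutation_of_isGeneric (p := 0) (k := k) fun m _ => hx (0 + m) m
  simpa using eq_of_isMutation (Y := fun i => liftY (0 + (i : ℤ)) (liftMap^[i] (deform U x))) hm
    (j := j) (by simpa using hj)

theorem liftY_eq_of_odd (h0 : IsGeneric 0 U) {k : ℕ} {j : ℤ}
    (hk : LiftYDefined (k + 1 : ℕ) (liftMap^[k + 1] U) j) (hj : Even (j + k))
    (h1 : F (liftY 0 U) (j - 1) k ≠ 0) (h2 : F (liftY 0 U) (j + 1) k ≠ 0) :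
    liftY (k + 1 : ℕ) (liftMap^[k + 1] U) j =
      (∏ i ∈ Finset.Icc (-(k : ℤ)) k, liftY 0 U (j + 3 * i))⁻¹ *
        (F (liftY 0 U) (j - 3) k * F (liftY 0 U) (j + 3) k /
          (F (liftY 0 U) (j - 1) k * F (liftY 0 U) (j + 1) k)) := by
  have hy : ∀ i, Tendsto (fun x => liftY 0 (deform U x) i) (𝓝 0) (𝓝 (liftY 0 U i)) := fun i =>
    tendsto_liftY (m := 0) (h0.liftYDefined i)
  have hprod : ∏ i ∈ Finset.Icc (-(k : ℤ)) k, liftY 0 U (j + 3 * i) ≠ 0 :=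
    Finset.prod_ne_zero_iff.2 fun i _ => h0.liftY_ne_zero _
  refine tendsto_nhds_unique_of_frequently_eq (tendsto_liftY hk)
    (((tendsto_finsetProd _ fun i _ => hy (j + 3 * i)).inv₀ hprod).mul
      (((tendsto_F hy (j - 3) k).mul (tendsto_F hy (j + 3) k)).div
        ((tendsto_F hy (j - 1) k).mul (tendsto_F hy (j + 1) k)) (mul_ne_zero h1 h2))) ?_
  refine (frequently_isGeneric U).mono fun x hx => ?_
  have hm := isMutation_of_isGeneric (p := 0) (k := k + 1) fun m _ => hx (0 + m) m
  simpa using eq_inv_of_isMutation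
    (Y := fun i => liftY (0 + (i : ℤ)) (liftMap^[i] (deform U x))) hm (j := j) (by simpa using hj)

end Deformation

end Pentagram

end

theorem theorem1p1 (n : ℕ) (hn : 1 ≤ n) (A : Pentagram.Polygon) (hZ : A.half = false)
    (hA : A.IsTwisted n) (hy : ∀ j, A.YDefined j) (k : ℕ) (hk : 1 ≤ k) (hT : A.IterDefined k) :
    -- the formula, wherever both of its sides are defined
    (∀ j : ℤ, (Pentagram.Polygon.pentagramMap^[k] A).YDefined j →
      (Even (j + k) →
        Pentagram.F A.y (j - 3) k ≠ 0 → Pentagram.F A.y (j + 3) k ≠ 0 →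
        (Pentagram.Polygon.pentagramMap^[k] A).y j =
          (∏ i ∈ Finset.Icc (-(k : ℤ)) k, A.y (j + 3 * i)) *
            ((Pentagram.F A.y (j - 1) k * Pentagram.F A.y (j + 1) k) /
              (Pentagram.F A.y (j - 3) k * Pentagram.F A.y (j + 3) k))) ∧
      (Odd (j + k) →
        Pentagram.F A.y (j - 1) (k - 1) ≠ 0 → Pentagram.F A.y (j + 1) (k - 1) ≠ 0 →
        (∏ i ∈ Finset.Icc (-(k : ℤ) + 1) (k - 1), A.y (j + 3 * i)) ≠ 0 ∧
        (Pentagram.Polygon.pentagramMap^[k] A).y j =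
          (∏ i ∈ Finset.Icc (-(k : ℤ) + 1) (k - 1), A.y (j + 3 * i))⁻¹ *
            ((Pentagram.F A.y (j - 3) (k - 1) * Pentagram.F A.y (j + 3) (k - 1)) /
              (Pentagram.F A.y (j - 1) (k - 1) * Pentagram.F A.y (j + 1) (k - 1))))) ∧
    -- the denominators do not vanish as soon as all the polygons up to `T^k(A)` have `y`-parameters
    ((∀ i ≤ k, ∀ j, (Pentagram.Polygon.pentagramMap^[i] A).YDefined j) →
      ∀ j : ℤ,
        (Even (j + k) →
          Pentagram.F A.y (j - 3) k ≠ 0 ∧ Pentagram.F A.y (j + 3) k ≠ 0) ∧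
        (Odd (j + k) →
          Pentagram.F A.y (j - 1) (k - 1) ≠ 0 ∧ Pentagram.F A.y (j + 1) (k - 1) ≠ 0)) := by
  set U : ℤ → Fin 3 → ℝ := fun d => (A.at₂ d).rep
  have hU : Pentagram.Represents 0 U A := Pentagram.represents_rep A hZ
  have hgen : Pentagram.IsGeneric 0 U := hU.isGeneric hy
  have hyU : A.y = Pentagram.liftY 0 U := funext fun j => hU.y_eq (hy j)
  have hrep : ∀ i ≤ k, Pentagram.Represents (i : ℤ) (Pentagram.liftMap^[i] U)
      (Pentagram.Polygon.pentagramMap^[i] A) := fun i hi => by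
    simpa using hU.iterate (k := i) fun m hm => hT m (lt_of_lt_of_le hm hi)
  obtain ⟨k, rfl⟩ : ∃ l, k = l + 1 := ⟨k - 1, by omega⟩
  have hodd : ∀ {j : ℤ}, Odd (j + (k + 1 : ℕ)) → Even (j + k) := fun {j} hj => by
    rw [Int.odd_iff] at hj
    rw [Int.even_iff]
    push_cast at hj
    omega
  have hIcc : Finset.Icc (-((k + 1 : ℕ) : ℤ) + 1) ((k + 1 : ℕ) - 1) = Finset.Icc (-(k : ℤ)) k := by
    congr 1 <;> push_cast <;> ring
  rw [hyU, hIcc, Nat.add_sub_cancel]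
  refine ⟨fun j hj => ⟨fun he h1 h2 => ?_, fun ho h1 h2 => ⟨?_, ?_⟩⟩, fun hall j => ?_⟩
  · rw [(hrep _ le_rfl).y_eq hj]
    exact Pentagram.liftY_eq_of_even hgen ((hrep _ le_rfl).liftYDefined hj) he h1 h2
  · exact Finset.prod_ne_zero_iff.2 fun i _ => hgen.liftY_ne_zero _
  · rw [(hrep _ le_rfl).y_eq hj]
    exact Pentagram.liftY_eq_of_odd hgen ((hrep _ le_rfl).liftYDefined hj) (hodd ho) h1 h2
  · have hm := Pentagram.isMutation_of_isGeneric (U := U) (p := 0) (k := k + 1) fun m hm => by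
      simpa using (hrep m hm).isGeneric (hall m hm)
    have hF : ∀ l ≤ k + 1, ∀ i : ℤ, Odd (i + l) → Pentagram.F (Pentagram.liftY 0 U) i l ≠ 0 := by
      intro l hl i hi
      simpa using Pentagram.F_ne_zero_of_isMutation
        (Y := fun i => Pentagram.liftY (0 + (i : ℤ)) (Pentagram.liftMap^[i] U))
        (fun i hi => hm i (lt_of_lt_of_le hi hl)) (j := i) (by simpa using hi)
    refine ⟨fun he => ?_, fun ho => ?_⟩
    · rw [Int.even_iff] at he
      exact ⟨hF _ le_rfl _ (by rw [Int.odd_iff]; omega), hF _ le_rfl _ (by rw [Int.odd_iff]; omega)⟩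
    · have he := hodd ho
      rw [Int.even_iff] at he
      exact ⟨hF k (Nat.le_succ k) _ (by rw [Int.odd_iff]; omega),
        hF k (Nat.le_succ k) _ (by rw [Int.odd_iff]; omega)⟩
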